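/- Let $\mathbb K$ be a field of characteristic $0$ and let $D=\bigoplus_{i\in\mathbb Z}D_i$ be a graded $\mathbb K$-vector space. For homogeneous $a_1,\dots,a_k$ and $\sigma\in S_k$ let $\epsilon(\sigma)=\epsilon(\sigma;a_1,\dots,a_k)$ be the Koszul sign, $a_{\sigma(1)}\odot\cdots\odot a_{\sigma(k)}=\epsilon(\sigma)\,a_1\odot\cdots\odot a_k$. Formulas below are for homogeneous arguments and are extended multilinearly. **Definitions.** All operations below are multilinear of degree $1$ and indexed by $k\ge1$. (1) An $A_\infty[1]$-algebra structure on $D$ is a family $\mu_k:D^{\otimes k}\to D$ with, for all $n\ge1$, $$\sum_{i+j=n+1}\sum_{\lambda=1}^{j}(-1)^{|a_1|+\cdots+|a_{\lambda-1}|}\mu_j(a_1,\dots,a_{\lambda-1},\mu_i(a_\lambda,\dots,a_{\lambda+i-1}),a_{\lambda+i},\dots,a_n)=0.$$ (2) An $L_\infty[1]$-algebra structure on $D$ is a family of graded symmetric maps $l_k:D^{\otimes k}\to D$, i.e. $l_k(a_{\sigma(1)},\dots,a_{\sigma(k)})=\epsilon(\sigma)\,l_k(a_1,\dots,a_k)$,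 with, for all $n\ge1$, $$\sum_{i+j=n+1}\ \sum_{\sigma\in S_{(i,n-i)}}\epsilon(\sigma)\,l_j(l_i(a_{\sigma(1)},\dots,a_{\sigma(i)}),a_{\sigma(i+1)},\dots,a_{\sigma(n)})=0,$$ where $S_{(i,n-i)}$ is the set of $(i,n-i)$-shuffles. (3) A $Dend_\infty[1]$-algebra structure on $D$ is a family $\mu_{k,[r]}:D^{\otimes k}\to D$, $1\le r\le k$, which is a Maurer–Cartan element, $[\mu,\mu]=0$, for the bracket $[\mu,\eta]=\mu\circ\eta-(-1)^{mn}\eta\circ\mu$ of families of degrees $m$ and $n$, where $$(\mu\circ\eta)_{N,[r]}(a_1,\dots,a_N)=\sum_{k+l=N+1}\sum_{i=1}^k(-1)^{n(|a_1|+\cdots+|a_{i-1}|)}\mu_{k,R_0[r]}\big(a_1,\dots,a_{i-1},\eta_{l,R_i[r]}(a_i,\dots,a_{i+l-1}),a_{i+l},\dots,a_N\big).$$ Here $R_0[r]=[r],[i],[r-l+1]$ and $R_i[r]=[1]+\cdots+[l],\ [r-i+1],\ [1]+\cdots+[l]$ according to whether $r<i$, $i\le r\le i+l-1$, or $r\ge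 i+l$; and $\eta_{l,[1]+\cdots+[l]}=\eta_{l,[1]}+\cdots+\eta_{l,[l]}$. (4) A $pre\text{-}Lie_\infty[1]$-algebra structure on $D$ is a family $\theta_k:D^{\otimes k}\to D$, graded symmetric in the first $k-1$ arguments, which is a Maurer–Cartan element, $[\theta,\theta]_{\mathrm{MN}}=0$, for the Matsushima–Nijenhuis bracket $[f,g]_{\mathrm{MN}}=f\circ g-(-1)^{mn}g\circ f$ of families of degrees $m$ and $n$, where $$(f\circ g)(a_1,\dots,a_N)=\sum_{\substack{i+j=N+1\\ j\ge2}}\ \sum_{\sigma\in S_{(i-1,1,j-2)}}\epsilon(\sigma)\,f_j(g_i(a_{\sigma(1)},\dots,a_{\sigma(i)}),a_{\sigma(i+1)},\dots,a_{\sigma(N-1)},a_N)$$ $$+\sum_{i+j=N+1}\ \sum_{\sigma\in S_{(j-1,i-1)}}(-1)^{n(|a_{\sigma(1)}|+\cdots+|a_{\sigma(j-1)}|)}\epsilon(\sigma)\,f_j(a_{\sigma(1)},\dots,a_{\sigma(j-1)},g_i(a_{\sigma(j)},\dots,a_{\sigma(N-1)},a_N)),$$ the sums being over shuffles $\sigma\in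 S_{N-1}$ of the indicated types. **Proposition.** Let $(D,\{\mu_{k,[r]}\}_{k\ge1,\,1\le r\le k})$ be a $Dend_\infty[1]$-algebra. Then: (a) the maps $\mu_k=\mu_{k,[1]}+\cdots+\mu_{k,[k]}$ form an $A_\infty[1]$-algebra structure on $D$, and its symmetrization $$l_k(a_1,\dots,a_k)=\sum_{\sigma\in S_k}\epsilon(\sigma)\,\mu_k(a_{\sigma(1)},\dots,a_{\sigma(k)})$$ is an $L_\infty[1]$-algebra structure on $D$; (b) the maps $$\theta_k(a_1,\dots,a_k)=\sum_{\sigma\in S_k}\epsilon(\sigma)\,\mu_{k,[\sigma^{-1}(k)]}(a_{\sigma(1)},\dots,a_{\sigma(k)})$$ form a $pre\text{-}Lie_\infty[1]$-algebra structure on $D$, and its subadjacent structure $$l'_k(a_1,\dots,a_k)=\sum_{i=1}^k(-1)^{|a_i|(|a_{i+1}|+\cdots+|a_k|)}\,\theta_k(a_1,\dots,\widehat{a_i},\dots,a_k,a_i)$$ is an $L_\infty[1]$-algebra structure on $D$; (c) the two $L_\infty[1]$-algebra structures coincide: $l_k=l'_k$ for all $k\ge1$. That is, the diagram formed by $Dend_\infty[1]\rightsquigarrow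 pre\text{-}Lie_\infty[1]\rightsquigarrow L_\infty[1]$ and $Dend_\infty[1]\rightsquigarrow A_\infty[1]\rightsquigarrow L_\infty[1]$ commutes. -/

import Mathlib

open scoped DirectSum

noncomputable section

namespace HomotopyDend

/-! ### Graded vector spaces and graded multilinear maps

A graded vector space is given by its components `D i`, `i : ℤ`; its total space is `⨁ i, D i`.
Families of operations are indexed so that the index `k : ℕ` stands for arity `k + 1`; hence all
arities `≥ 1`, and only those, occur. Positions are numbered from `0`. -/

/-- The total space `⨁ i, D i` of a graded vector space. -/
abbrev Tot (D : ℤ → Type*) [∀ i, AddCommGroup (D i)] : Type _ := ⨁ i, D i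

/-- Multilinear maps `D^{⊗ (k+1)} → D`. -/
abbrev Op (K : Type*) [Field K] (D : ℤ → Type*) [∀ i, AddCommGroup (D i)] [∀ i, Module K (D i)]
    (k : ℕ) : Type _ :=
  MultilinearMap K (fun _ : Fin (k + 1) => Tot D) (Tot D)

section Signs

/-- The Koszul sign `ε(σ; v₁, …, v_k)` of homogeneous elements with degrees `d`, that is
`v_{σ(1)} ⊙ ⋯ ⊙ v_{σ(k)} = ε(σ) v₁ ⊙ ⋯ ⊙ v_k`: each inversion of `σ` contributes the sign of
interchanging the two corresponding elements. -/
def koszulSign {k : ℕ} (σ : Equiv.Perm (Fin k)) (d : Fin k → ℤ) : ℤˣ :=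
  ∏ p : Fin k, ∏ q : Fin k,
    if p < q ∧ σ q < σ p then Int.negOnePow (d (σ p) * d (σ q)) else 1

/-- `d 0 + ⋯ + d (t - 1)`: the total degree of the entries before position `t`. -/
def degBefore {k : ℕ} (d : Fin k → ℤ) (t : ℕ) : ℤ :=
  ∑ p : Fin k, if (p : ℕ) < t then d p else 0

/-- The total degree of the entries after position `t`. -/
def degAfter {k : ℕ} (d : Fin k → ℤ) (t : Fin k) : ℤ :=
  ∑ p : Fin k, if t < p then d p else 0

end Signs

section Shuffles

/-- `σ` is increasing on the positions `lo, …, hi - 1`. -/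
abbrev IncreasingOn {n : ℕ} (σ : Equiv.Perm (Fin n)) (lo hi : ℕ) : Prop :=
  ∀ p q : Fin n, lo ≤ (p : ℕ) → p < q → (q : ℕ) < hi → σ p < σ q

/-- The `(i, n - i)`-shuffles in `S_n`. -/
def shuffles (n i : ℕ) : Finset (Equiv.Perm (Fin n)) :=
  Finset.univ.filter fun σ => IncreasingOn σ 0 i ∧ IncreasingOn σ i n

/-- The `(i, 1, N - i - 1)`-shuffles in `S_N`, as permutations of `N + 1` letters that fix the last
one. -/
def shufflesOne (N i : ℕ) : Finset (Equiv.Perm (Fin (N + 1))) :=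
  Finset.univ.filter fun σ =>
    σ (Fin.last N) = Fin.last N ∧ IncreasingOn σ 0 i ∧ IncreasingOn σ (i + 1) N

/-- The `(i, N - i)`-shuffles in `S_N`, as permutations of `N + 1` letters that fix the last one. -/
def shufflesFix (N i : ℕ) : Finset (Equiv.Perm (Fin (N + 1))) :=
  Finset.univ.filter fun σ =>
    σ (Fin.last N) = Fin.last N ∧ IncreasingOn σ 0 i ∧ IncreasingOn σ i N

end Shuffles

section Insertion

variable {α : Type*} {N : ℕ}

/-- The block `a_t, …, a_{t+i}` of `i + 1` consecutive entries of `(a_0, …, a_N)`. -/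
def block (a : Fin (N + 1) → α) (i : Fin (N + 1)) (t : Fin (N - i + 1)) : Fin (i + 1) → α :=
  fun s => a ⟨t + s, by omega⟩

/-- The tuple `(a_0, …, a_{t-1}, y, a_{t+i+1}, …, a_N)`: the block `a_t, …, a_{t+i}` is replaced by
the single entry `y`. -/
def plug (a : Fin (N + 1) → α) (i : Fin (N + 1)) (t : Fin (N - i + 1)) (y : α) :
    Fin (N - i + 1) → α :=
  fun p => if p < t then a ⟨p, by omega⟩ else if p = t then y else a ⟨p + i, by omega⟩

/-- The map `R₀(k; 1, …, l, …, 1) : C_{k+l-1} → C_k`, with `l = i + 1` at position `t`,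
`k = N - i + 1`. -/
def dendR0 (i : Fin (N + 1)) (t : Fin (N - i + 1)) (r : Fin (N + 1)) : Fin (N - i + 1) :=
  if h₁ : (r : ℕ) < t then ⟨r, by omega⟩
  else if h₂ : (r : ℕ) ≤ t + i then t
  else ⟨r - i, by omega⟩

/-- The map `R_t(k; 1, …, l, …, 1) : C_{k+l-1} → 𝕂[C_l]`, with `l = i + 1` at position `t`. A finite
set stands for the formal sum of its elements. -/
def dendRi (i : Fin (N + 1)) (t : Fin (N - i + 1)) (r : Fin (N + 1)) : Finset (Fin (i + 1)) :=
  if h : (t : ℕ) ≤ r ∧ (r : ℕ) ≤ t + i then {⟨r - t, by omega⟩} else Finset.univ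

/-- The permutation that moves the `i`-th entry to the end: `x ∘ moveToEnd i` is
`(x_0, …, x̂_i, …, x_k, x_i)`. -/
def moveToEnd {k : ℕ} (i : Fin (k + 1)) : Equiv.Perm (Fin (k + 1)) :=
  finSuccEquivLast.trans (finSuccEquiv' i).symm

theorem moveToEnd_last {k : ℕ} (i : Fin (k + 1)) : moveToEnd i (Fin.last k) = i := by
  simp [moveToEnd]

theorem moveToEnd_castSucc {k : ℕ} (i : Fin (k + 1)) (p : Fin k) :
    moveToEnd i p.castSucc = i.succAbove p := by
  simp [moveToEnd]

end Insertion

section Algebras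

variable {K : Type*} [Field K] {D : ℤ → Type*} [∀ i, AddCommGroup (D i)] [∀ i, Module K (D i)]

variable (K) in
/-- The tuple in the total space whose `p`-th entry is the homogeneous element `x p`, of degree
`d p`. -/
def hom {k : ℕ} (d : Fin k → ℤ) (x : ∀ p, D (d p)) : Fin k → Tot D :=
  fun p => DirectSum.lof K ℤ D (d p) (x p)

/-- `f` is homogeneous of degree `m`. -/
def HasDegree {k : ℕ} (m : ℤ) (f : Op K D k) : Prop :=
  ∀ (d : Fin (k + 1) → ℤ) (x : ∀ p, D (d p)),
    ∃ y : D ((∑ p, d p) + m), f (hom K d x) = DirectSum.lof K ℤ D _ y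

/-- The multilinear map `(a_1, …, a_k) ↦ ∑_{j ∈ J} s_j(a) f_j(a_{σ_j(1)}, …, a_{σ_j(k)})`, where the
sign `s_j(a)` depends on the degrees of the homogeneous elements `a_1, …, a_k`. It is prescribed on
homogeneous elements and extended multilinearly. -/
def signedSum {k : ℕ} {J : Type*} [Fintype J] (s : J → (Fin (k + 1) → ℤ) → ℤˣ)
    (σ : J → Equiv.Perm (Fin (k + 1))) (f : J → Op K D k) : Op K D k :=
  MultilinearMap.fromDirectSumEquiv fun d =>
    ∑ j, s j d • ((f j).domDomCongr (σ j)).compLinearMap fun p => DirectSum.lof K ℤ D (d p)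

theorem signedSum_hom {k : ℕ} {J : Type*} [Fintype J] (s : J → (Fin (k + 1) → ℤ) → ℤˣ)
    (σ : J → Equiv.Perm (Fin (k + 1))) (f : J → Op K D k) (d : Fin (k + 1) → ℤ)
    (x : ∀ p, D (d p)) :
    signedSum s σ f (hom K d x) = ∑ j, s j d • f j (hom K d x ∘ σ j) := by
  unfold signedSum hom
  rw [MultilinearMap.fromDirectSumEquiv_lof, MultilinearMap.sum_apply]
  rfl

/-! ### `A_∞[1]`-algebras -/

/-- The operations `μ_k` (of degree `1`) form an `A_∞[1]`-algebra structure. -/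
structure IsAInfty (μ : ∀ k, Op K D k) : Prop where
  degree : ∀ k, HasDegree 1 (μ k)
  relation : ∀ (N : ℕ) (d : Fin (N + 1) → ℤ) (x : ∀ p, D (d p)),
    ∑ i : Fin (N + 1), ∑ t : Fin (N - i + 1),
      Int.negOnePow (degBefore d t) •
        μ (N - i) (plug (hom K d x) i t (μ i (block (hom K d x) i t))) = 0

/-! ### `L_∞[1]`-algebras -/

/-- The operations `l_k` (of degree `1`) form an `L_∞[1]`-algebra structure. -/
structure IsLInfty (l : ∀ k, Op K D k) : Prop where
  degree : ∀ k, HasDegree 1 (l k)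
  symmetric : ∀ (k : ℕ) (σ : Equiv.Perm (Fin (k + 1))) (d : Fin (k + 1) → ℤ) (x : ∀ p, D (d p)),
    l k (hom K d x ∘ σ) = koszulSign σ d • l k (hom K d x)
  jacobi : ∀ (N : ℕ) (d : Fin (N + 1) → ℤ) (x : ∀ p, D (d p)),
    ∑ i : Fin (N + 1), ∑ σ ∈ shuffles (N + 1) (i + 1),
      koszulSign σ d •
        l (N - i) (plug (hom K d x ∘ σ) i 0 (l i (block (hom K d x ∘ σ) i 0))) = 0

/-! ### `Dend_∞[1]`-algebras -/

variable (K D) in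
/-- An element of `Hom(TD ⊗ D ⊗ TD, D)`: a collection of maps `μ_{k,[r]} : D^{⊗ k} → D`, `k ≥ 1`,
`[r] ∈ C_k`. -/
abbrev DendOps : Type _ := ∀ k : ℕ, Fin (k + 1) → Op K D k

/-- The value of `μ ∘ η` at `a_0 ⋯ a_{r-1} ⊗ a_r ⊗ a_{r+1} ⋯ a_N`, where `η` has degree `n` and
`a = (x_0, …, x_N)` is homogeneous of degrees `d`. -/
def dendCirc (n : ℤ) (μ η : DendOps K D) (N : ℕ) (r : Fin (N + 1)) (d : Fin (N + 1) → ℤ)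
    (x : ∀ p, D (d p)) : Tot D :=
  ∑ i : Fin (N + 1), ∑ t : Fin (N - i + 1),
    Int.negOnePow (n * degBefore d t) •
      μ (N - i) (dendR0 i t r) (plug (hom K d x) i t
        (∑ s ∈ dendRi i t r, η i s (block (hom K d x) i t)))

/-- The graded Lie bracket of `μ` (of degree `m`) and `η` (of degree `n`) in
`⨁ₙ Homₙ(TD ⊗ D ⊗ TD, D)`, evaluated on homogeneous elements. -/
def dendBracket (m n : ℤ) (μ η : DendOps K D) (N : ℕ) (r : Fin (N + 1)) (d : Fin (N + 1) → ℤ)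
    (x : ∀ p, D (d p)) : Tot D :=
  dendCirc n μ η N r d x - Int.negOnePow (m * n) • dendCirc m η μ N r d x

/-- `μ` is a `Dend_∞[1]`-algebra structure, i.e. a Maurer–Cartan element (of degree `1`). -/
structure IsDendInfty (μ : DendOps K D) : Prop where
  degree : ∀ k r, HasDegree 1 (μ k r)
  maurerCartan : ∀ (N : ℕ) (r : Fin (N + 1)) (d : Fin (N + 1) → ℤ) (x : ∀ p, D (d p)),
    dendBracket 1 1 μ μ N r d x = 0

/-! ### `pre-Lie_∞[1]`-algebras -/

/-- `θ` lies in `Hom(S(W) ⊗ W, W)`: each `θ_k` is graded symmetric in all arguments but the last. -/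
def IsSymmetricButLast (θ : ∀ k, Op K D k) : Prop :=
  ∀ (k : ℕ) (σ : Equiv.Perm (Fin (k + 1))), σ (Fin.last k) = Fin.last k →
    ∀ (d : Fin (k + 1) → ℤ) (x : ∀ p, D (d p)),
      θ k (hom K d x ∘ σ) = koszulSign σ d • θ k (hom K d x)

/-- The product on `Hom(S(W) ⊗ W, W)` underlying the Matsushima–Nijenhuis bracket,
`(f ∘ g)(v_1, …, v_n) = ∑ ε(σ) f(g(v_{σ(1)}, …, v_{σ(i)}), v_{σ(i+1)}, …, v_{σ(n-1)}, v_n)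
  + ∑ ± ε(σ) f(v_{σ(1)}, …, v_{σ(j-1)}, g(v_{σ(j)}, …, v_{σ(n-1)}, v_n))`,
over `i + j = n + 1`, with `σ` an `(i-1, 1, j-2)`-shuffle (and `j ≥ 2`) in the first sum and a
`(j-1, i-1)`-shuffle in the second, where the sign is that of moving `g`, of degree `m`, past
`v_{σ(1)}, …, v_{σ(j-1)}`. -/
def mnCirc (m : ℤ) (f g : ∀ k, Op K D k) (N : ℕ) (d : Fin (N + 1) → ℤ) (x : ∀ p, D (d p)) :
    Tot D :=
  (∑ i : Fin (N + 1), if (i : ℕ) < N then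
      ∑ σ ∈ shufflesOne N i, koszulSign σ d •
        f (N - i) (plug (hom K d x ∘ σ) i 0 (g i (block (hom K d x ∘ σ) i 0)))
    else 0) +
  ∑ i : Fin (N + 1), ∑ σ ∈ shufflesFix N (N - i),
    (Int.negOnePow (m * degBefore (d ∘ σ) (N - i)) * koszulSign σ d) •
      f (N - i) (plug (hom K d x ∘ σ) i (Fin.last (N - i))
        (g i (block (hom K d x ∘ σ) i (Fin.last (N - i)))))

/-- The Matsushima–Nijenhuis bracket of `f` (of degree `m`) and `g` (of degree `n`), evaluated on
homogeneous elements. -/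
def mnBracket (m n : ℤ) (f g : ∀ k, Op K D k) (N : ℕ) (d : Fin (N + 1) → ℤ) (x : ∀ p, D (d p)) :
    Tot D :=
  mnCirc n f g N d x - Int.negOnePow (m * n) • mnCirc m g f N d x

/-- `θ` is a `pre-Lie_∞[1]`-algebra structure, i.e. a Maurer–Cartan element (of degree `1`) of
`⨁ₙ Homₙ(S(W) ⊗ W, W)` with the Matsushima–Nijenhuis bracket. -/
structure IsPreLieInfty (θ : ∀ k, Op K D k) : Prop where
  degree : ∀ k, HasDegree 1 (θ k)
  symmetric : IsSymmetricButLast θ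
  maurerCartan : ∀ (N : ℕ) (d : Fin (N + 1) → ℤ) (x : ∀ p, D (d p)),
    mnBracket 1 1 θ θ N d x = 0

/-! ### The four constructions -/

/-- `Dend_∞[1] ⇝ A_∞[1]`: `μ_k = μ_{k,[1]} + ⋯ + μ_{k,[k]}`. -/
def dendToA (μ : DendOps K D) : ∀ k, Op K D k :=
  fun k => ∑ r, μ k r

/-- `A_∞[1] ⇝ L_∞[1]`: the symmetrization
`l_k(a_1, …, a_k) = ∑_{σ ∈ S_k} ε(σ) μ_k(a_{σ(1)}, …, a_{σ(k)})`. -/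
def symmetrization (μ : ∀ k, Op K D k) : ∀ k, Op K D k :=
  fun k => signedSum (fun σ d => koszulSign σ d) (fun σ : Equiv.Perm (Fin (k + 1)) => σ)
    fun _ => μ k

/-- `Dend_∞[1] ⇝ pre-Lie_∞[1]`:
`θ_k(a_1, …, a_k) = ∑_{σ ∈ S_k} ε(σ) μ_{k,[σ⁻¹(k)]}(a_{σ(1)}, …, a_{σ(k)})`. -/
def dendToPreLie (μ : DendOps K D) : ∀ k, Op K D k :=
  fun k => signedSum (fun σ d => koszulSign σ d) (fun σ : Equiv.Perm (Fin (k + 1)) => σ)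
    fun σ => μ k (σ.symm (Fin.last k))

/-- `pre-Lie_∞[1] ⇝ L_∞[1]`: the subadjacent structure, `l_k(x_1, …, x_k) =
∑_i (-1)^{|x_i| (|x_{i+1}| + ⋯ + |x_k|)} θ_k(x_1, …, x̂_i, …, x_k, x_i)`. -/
def subadjacent (θ : ∀ k, Op K D k) : ∀ k, Op K D k :=
  fun k => signedSum (fun i d => Int.negOnePow (d i * degAfter d i)) moveToEnd fun _ => θ k

end Algebras

end HomotopyDend

end

noncomputable section

namespace HomotopyDend

open Equiv Finset

/-! ### Koszul signs -/

section KoszulSign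

/-! All constructions are sums over permutations, and the relations are compared permutation by
permutation. Inserting one symmetrized operation into another gives nested permutations `nest t₀ π
τ`, where `π` permutes the outer slots (the block counting as one slot) and `τ` the block. Composing
these with the shuffles `σ` of the `L_∞` or pre-Lie relation, the products `σ * nest t₀ π τ` run
through every permutation `ρ` exactly once for each place of the block and each position of the
marked entries. The signs match because the Koszul sign is a cocycle (`koszulSign_mul`) and the
degree-one inner operation accounts for the remaining sign (`negOnePow_mul_koszulSign_nest`). The
counting is a coset argument (`sum_increasingOnFibers_mul`), applied in `sum_shuffles`,
`sum_shufflesFix` and `sum_shufflesOne`.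

For fixed `ρ`, what remains of the `L_∞` relation of a symmetrization is the `A_∞` relation of the
permuted tuple. In the pre-Lie product it is `μ ∘ μ` at the mark `r = ρ⁻¹(last)`: the two sums of
the Matsushima–Nijenhuis product are the cases where the mark lies outside or inside the block,
which is the case distinction in `R_0` and `R_i` (`mnCirc_dendToPreLie`). Summing `μ ∘ μ` over all
marks gives the `A_∞` relation. In characteristic zero, `[μ, μ] = 2 μ ∘ μ` makes each `μ ∘ μ`
vanish.

For (c), `S_k` is cut into the cosets of the stabilizer of the last letter, with representatives
`moveToEnd i`; summing over `i` places every mark once. The `L_∞` relation of the subadjacent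
structure then follows from this equality. -/

theorem negOnePow_sum {ι : Type*} (s : Finset ι) (f : ι → ℤ) :
    (∑ p ∈ s, f p).negOnePow = ∏ p ∈ s, (f p).negOnePow := by
  induction s using Finset.cons_induction with
  | empty => simp
  | cons a s ha ih => rw [sum_cons, prod_cons, Int.negOnePow_add, ih]

/-- Regroups a product by unordered pairs, so that products over inversions can be compared pair by
pair even when a permutation reverses a pair. -/
theorem prod_prod_eq_prod_pairs {n : ℕ} {M : Type*} [CommMonoid M] (f : Fin n → Fin n → M)
    (h : ∀ p, f p p = 1) :
    ∏ p, ∏ q, f p q = ∏ p, ∏ q, if p < q then f p q * f q p else 1 := by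
  have h1 : ∀ p q, f p q = (if p < q then f p q else 1) * (if q < p then f p q else 1) := by
    intro p q
    rcases lt_trichotomy p q with hpq | rfl | hpq
    · simp [hpq, hpq.not_gt]
    · simp [h]
    · simp [hpq, hpq.not_gt]
  have h2 : ∀ p q, (if p < q then f p q * f q p else 1) =
      (if p < q then f p q else 1) * (if p < q then f q p else 1) := by
    intro p q
    split_ifs <;> simp
  simp_rw [h2, Finset.prod_mul_distrib]
  conv_lhs => enter [2, p, 2, q]; rw [h1 p q]
  simp_rw [Finset.prod_mul_distrib]
  congr 1
  exact Finset.prod_comm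

/-- The cocycle identity: a pair is inverted by `σ * τ` iff exactly one of `τ` (on the pair) and `σ`
(on its image) inverts it; if both do, the two equal signs cancel. -/
theorem koszulSign_mul {n : ℕ} (σ τ : Perm (Fin n)) (d : Fin n → ℤ) :
    koszulSign (σ * τ) d = koszulSign σ d * koszulSign τ (d ∘ σ) := by
  have hσ : koszulSign σ d = ∏ p, ∏ q, if τ p < τ q ∧ σ (τ q) < σ (τ p) then
      Int.negOnePow (d (σ (τ p)) * d (σ (τ q))) else 1 := by
    unfold koszulSign
    refine (Fintype.prod_equiv τ _ _ fun p => ?_).symm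
    exact Fintype.prod_equiv τ _ _ fun q => rfl
  rw [hσ]
  unfold koszulSign
  simp_rw [← Finset.prod_mul_distrib]
  refine (prod_prod_eq_prod_pairs _ (by simp)).trans
    (Eq.trans ?_ (prod_prod_eq_prod_pairs _ (by simp)).symm)
  refine Finset.prod_congr rfl fun p _ => Finset.prod_congr rfl fun q _ => ?_
  by_cases hpq : p < q
  · have h1 : τ p ≠ τ q := fun h => hpq.ne (τ.injective h)
    have h2 : σ (τ p) ≠ σ (τ q) := fun h => h1 (σ.injective h)
    rw [if_pos hpq, if_pos hpq]
    rcases lt_or_gt_of_ne h1 with h1 | h1 <;> rcases lt_or_gt_of_ne h2 with h2 | h2 <;>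
      simp [hpq, hpq.not_gt, h1, h1.not_gt, h2, h2.not_gt, mul_comm (d (σ (τ q)))]
  · rw [if_neg hpq, if_neg hpq]

/-- Raising the degree of the entry `t₀` by one changes the Koszul sign of `π` in the same way as
moving an operator of degree one from the entry `t₀` to its new position. -/
theorem negOnePow_degBefore_mul_koszulSign {n : ℕ} (π : Perm (Fin n)) (d d' : Fin n → ℤ)
    (t t₀ : Fin n) (ht : π t = t₀) (hd : ∀ p, p ≠ t₀ → d' p = d p) (ht₀ : d' t₀ = d t₀ + 1) :
    Int.negOnePow (degBefore d t₀) * koszulSign π d' =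
      koszulSign π d * Int.negOnePow (degBefore (d ∘ π) t) := by
  have hv : ∀ p, p ≠ t → d' (π p) = d (π p) := fun p hp =>
    hd _ fun h => hp (π.injective (h.trans ht.symm))
  have hne : ∀ p, p ≠ t → π p ≠ t₀ := fun p hp h => hp (π.injective (h.trans ht.symm))
  -- Only inversions involving the entry `t₀` feel the change of degree, and each gains the sign of
  -- the other entry.
  have key : koszulSign π d' = koszulSign π d *
      ((∏ p, if p < t ∧ t₀ < π p then Int.negOnePow (d (π p)) else 1) *
        ∏ q, if t < q ∧ π q < t₀ then Int.negOnePow (d (π q)) else 1) := by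
    -- Spreading the single products over pairs, with support on `q = t` or `p = t`, allows a
    -- factorwise comparison.
    have h1 : (∏ p, if p < t ∧ t₀ < π p then Int.negOnePow (d (π p)) else 1) =
        ∏ p, ∏ q, if q = t then
          (if p < t ∧ t₀ < π p then Int.negOnePow (d (π p)) else 1) else 1 :=
      Finset.prod_congr rfl fun p _ => by simp
    have h2 : (∏ q, if t < q ∧ π q < t₀ then Int.negOnePow (d (π q)) else 1) =
        ∏ p, ∏ q, if p = t then
          (if t < q ∧ π q < t₀ then Int.negOnePow (d (π q)) else 1) else 1 := by
      rw [Finset.prod_comm]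
      exact Finset.prod_congr rfl fun p _ => by simp
    rw [h1, h2]
    unfold koszulSign
    simp_rw [← Finset.prod_mul_distrib]
    refine Finset.prod_congr rfl fun p _ => Finset.prod_congr rfl fun q _ => ?_
    by_cases hp : p = t <;> by_cases hq : q = t
    · subst hp; subst hq; simp
    · subst hp
      rw [ht, hv q hq, ht₀]
      by_cases h : p < q ∧ π q < t₀
      · simp [h, hq, add_mul, Int.negOnePow_add]
      · simp only [h, if_false, hq, if_true, mul_one]
    · subst hq
      rw [ht, hv p hp, ht₀]
      by_cases h : p < q ∧ t₀ < π p
      · simp [h, hp, mul_add, Int.negOnePow_add]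
      · simp only [h, if_false, hp, if_true, mul_one]
    · simp [hp, hq, hv p hp, hv q hq]
  have e1 : Int.negOnePow (degBefore d t₀) =
      ∏ p, if π p < t₀ then Int.negOnePow (d (π p)) else 1 := by
    rw [degBefore, negOnePow_sum]
    refine (Fintype.prod_equiv π _ _ fun p => ?_).symm
    simp only [Fin.val_fin_lt]
    split_ifs <;> simp
  have e2 : Int.negOnePow (degBefore (d ∘ π) t) =
      ∏ p, if p < t then Int.negOnePow (d (π p)) else 1 := by
    rw [degBefore, negOnePow_sum]
    refine Finset.prod_congr rfl fun p _ => ?_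
    simp only [Fin.val_fin_lt]
    split_ifs <;> simp
  rw [key, mul_left_comm, e1, e2]
  congr 1
  simp_rw [← Finset.prod_mul_distrib]
  refine Finset.prod_congr rfl fun p _ => ?_
  by_cases hp : p = t
  · subst hp; simp [ht]
  · rcases lt_or_gt_of_ne hp with h1 | h1 <;> rcases lt_or_gt_of_ne (hne p hp) with h2 | h2 <;>
      simp [h1, h1.not_gt, h2, h2.not_gt]

end KoszulSign

/-! ### Nested permutations -/

section Slots

variable {N : ℕ} {i : Fin (N + 1)}

/-- The position in `(a_0, …, a_N)` of the `s`-th entry of the block of length `i + 1` at `t`. -/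
def blockPos (t : Fin (N - i + 1)) (s : Fin (i + 1)) : Fin (N + 1) := ⟨t + s, by omega⟩

/-- The position in `(a_0, …, a_N)` of the entry at position `p ≠ t` after the block of length
`i + 1` at `t` is replaced by a single entry. -/
def outerPos (t p : Fin (N - i + 1)) : Fin (N + 1) :=
  if p < t then ⟨p, by omega⟩ else ⟨p + i, by omega⟩

theorem val_blockPos (t : Fin (N - i + 1)) (s : Fin (i + 1)) :
    (blockPos t s : ℕ) = t + s := rfl

theorem val_outerPos (t p : Fin (N - i + 1)) :
    (outerPos t p : ℕ) = if (p : ℕ) < t then (p : ℕ) else p + i := by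
  unfold outerPos
  simp only [← Fin.val_fin_lt]
  split_ifs <;> rfl

theorem val_outerPos_zero (p : Fin (N - i + 1)) : (outerPos 0 p : ℕ) = p + i :=
  (val_outerPos 0 p).trans (if_neg (Nat.not_lt_zero _))

theorem val_outerPos_last {p : Fin (N - i + 1)} (hp : p ≠ Fin.last (N - i)) :
    (outerPos (Fin.last (N - i)) p : ℕ) = p :=
  (val_outerPos _ p).trans (if_pos (Fin.lt_last_iff_ne_last.2 hp))

theorem slot_cases (t : Fin (N - i + 1)) (p : Fin (N + 1)) :
    (∃ s, p = blockPos t s) ∨ ∃ q, q ≠ t ∧ p = outerPos t q := by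
  rcases lt_or_ge (p : ℕ) t with h | h
  · refine Or.inr ⟨⟨p, by omega⟩, ?_, ?_⟩
    · simp only [ne_eq, Fin.ext_iff]; omega
    · rw [Fin.ext_iff, val_outerPos]; simp [h]
  · rcases le_or_gt (p : ℕ) (t + i) with h' | h'
    · exact Or.inl ⟨⟨p - t, by omega⟩, by rw [Fin.ext_iff, val_blockPos]; simp; omega⟩
    · refine Or.inr ⟨⟨p - i, by omega⟩, ?_, ?_⟩
      · simp only [ne_eq, Fin.ext_iff]; omega
      · rw [Fin.ext_iff, val_outerPos]; simp only
        split_ifs <;> omega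

theorem blockPos_lt_blockPos (t : Fin (N - i + 1)) (s s' : Fin (i + 1)) :
    blockPos t s < blockPos t s' ↔ s < s' := by
  simp only [Fin.lt_def, val_blockPos]; omega

theorem blockPos_lt_outerPos {t p : Fin (N - i + 1)} (hp : p ≠ t) (s : Fin (i + 1)) :
    blockPos t s < outerPos t p ↔ t < p := by
  have := Fin.val_ne_of_ne hp
  simp only [Fin.lt_def, val_blockPos, val_outerPos]; split_ifs <;> omega

theorem outerPos_lt_blockPos {t p : Fin (N - i + 1)} (hp : p ≠ t) (s : Fin (i + 1)) :
    outerPos t p < blockPos t s ↔ p < t := by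
  have := Fin.val_ne_of_ne hp
  simp only [Fin.lt_def, val_blockPos, val_outerPos]; split_ifs <;> omega

theorem outerPos_lt_outerPos {t p q : Fin (N - i + 1)} (hp : p ≠ t) (hq : q ≠ t) :
    outerPos t p < outerPos t q ↔ p < q := by
  have := Fin.val_ne_of_ne hp
  have := Fin.val_ne_of_ne hq
  simp only [Fin.lt_def, val_outerPos]; split_ifs <;> omega

theorem outerPos_lt_iff {t p : Fin (N - i + 1)} (hp : p ≠ t) :
    (outerPos t p : ℕ) < t ↔ p < t := by
  have := Fin.val_ne_of_ne hp
  simp only [Fin.lt_def, val_outerPos]; split_ifs <;> omega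

/-- The positions in `(a_0, …, a_N)`: those of the block at `t`, and the remaining ones. -/
def slotEquiv (t : Fin (N - i + 1)) : Fin (i + 1) ⊕ {p : Fin (N - i + 1) // p ≠ t} ≃ Fin (N + 1) :=
  Equiv.ofBijective (Sum.elim (blockPos t) fun p => outerPos t p.1) <| by
    constructor
    · rintro (s | ⟨p, hp⟩) (s' | ⟨q, hq⟩) h <;> simp only [Sum.elim_inl, Sum.elim_inr] at h
      · rw [Fin.ext_iff, val_blockPos, val_blockPos] at h
        rw [Fin.ext (by omega : (s : ℕ) = s')]
      · have h1 := blockPos_lt_outerPos hq s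
        have h2 := outerPos_lt_blockPos hq s
        rw [h] at h1 h2
        simp only [lt_self_iff_false, false_iff] at h1 h2
        exact absurd (le_antisymm (not_lt.1 h1) (not_lt.1 h2)) hq
      · have h1 := blockPos_lt_outerPos hp s'
        have h2 := outerPos_lt_blockPos hp s'
        rw [h] at h1 h2
        simp only [lt_self_iff_false, false_iff] at h1 h2
        exact absurd (le_antisymm (not_lt.1 h1) (not_lt.1 h2)) hp
      · have h1 := outerPos_lt_outerPos hp hq
        have h2 := outerPos_lt_outerPos hq hp
        rw [h] at h1 h2
        simp only [lt_self_iff_false, false_iff] at h1 h2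
        simp only [le_antisymm (not_lt.1 h2) (not_lt.1 h1)]
    · intro p
      rcases slot_cases t p with ⟨s, rfl⟩ | ⟨q, hq, rfl⟩
      · exact ⟨Sum.inl s, rfl⟩
      · exact ⟨Sum.inr ⟨q, hq⟩, rfl⟩

theorem slotEquiv_inl (t : Fin (N - i + 1)) (s : Fin (i + 1)) :
    slotEquiv t (Sum.inl s) = blockPos t s := rfl

theorem slotEquiv_inr (t : Fin (N - i + 1)) (p : {p // p ≠ t}) :
    slotEquiv t (Sum.inr p) = outerPos t p.1 := rfl

theorem outerPos_ne_blockPos {t p : Fin (N - i + 1)} (hp : p ≠ t) (s : Fin (i + 1)) :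
    outerPos t p ≠ blockPos t s := fun h =>
  Sum.inr_ne_inl ((slotEquiv t).injective (a₁ := Sum.inr ⟨p, hp⟩) (a₂ := Sum.inl s) h)

theorem blockPos_injective (t : Fin (N - i + 1)) : Function.Injective (blockPos t) := fun _ _ h =>
  Sum.inl_injective ((slotEquiv t).injective h)

theorem outerPos_inj {t p q : Fin (N - i + 1)} (hp : p ≠ t) (hq : q ≠ t)
    (h : outerPos t p = outerPos t q) : p = q :=
  congrArg Subtype.val (Sum.inr_injective
    ((slotEquiv t).injective (a₁ := Sum.inr ⟨p, hp⟩) (a₂ := Sum.inr ⟨q, hq⟩) h))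

/-- Blocks have equal length, so containment forces equality; the two end points suffice. -/
theorem blockPos_inj_left {t t' : Fin (N - i + 1)} (h : ∀ s, ∃ s', blockPos t s = blockPos t' s') :
    t = t' := by
  obtain ⟨s, hs⟩ := h 0
  obtain ⟨s', hs'⟩ := h (Fin.last _)
  simp only [Fin.ext_iff, val_blockPos, Fin.val_last, Fin.val_zero] at hs hs' ⊢
  omega

theorem prod_slots {M : Type*} [CommMonoid M] (t : Fin (N - i + 1)) (f : Fin (N + 1) → M) :
    ∏ p, f p = (∏ s, f (blockPos t s)) * ∏ p : {p // p ≠ t}, f (outerPos t p.1) := by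
  rw [← Fintype.prod_equiv (slotEquiv t) (fun x => f (slotEquiv t x)) f fun _ => rfl,
    Fintype.prod_sum_type]
  rfl

theorem sum_slots {M : Type*} [AddCommMonoid M] (t : Fin (N - i + 1)) (f : Fin (N + 1) → M) :
    ∑ p, f p = (∑ s, f (blockPos t s)) + ∑ p : {p // p ≠ t}, f (outerPos t p.1) := by
  rw [← Fintype.sum_equiv (slotEquiv t) (fun x => f (slotEquiv t x)) f fun _ => rfl,
    Fintype.sum_sum_type]
  rfl

theorem block_eq_comp {α : Type*} (a : Fin (N + 1) → α) (t : Fin (N - i + 1)) :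
    block a i t = a ∘ blockPos t := rfl

theorem plug_self {α : Type*} (a : Fin (N + 1) → α) (t : Fin (N - i + 1)) (y : α) :
    plug a i t y t = y := by
  simp [plug]

theorem plug_of_ne {α : Type*} (a : Fin (N + 1) → α) {t p : Fin (N - i + 1)} (hp : p ≠ t) (y : α) :
    plug a i t y p = a (outerPos t p) := by
  unfold plug outerPos
  split_ifs <;> rfl

theorem plug_eq_update {α : Type*} (a : Fin (N + 1) → α) (t : Fin (N - i + 1)) (y z : α) :
    plug a i t y = Function.update (plug a i t z) t y := by
  ext p
  by_cases hp : p = t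
  · subst hp; simp [plug_self]
  · simp [plug_of_ne, hp]

theorem degBefore_plug (d : Fin (N + 1) → ℤ) (t : Fin (N - i + 1)) (y : ℤ) :
    degBefore (plug d i t y) t = degBefore d t := by
  rw [degBefore, degBefore, sum_slots t, Fintype.sum_eq_add_sum_subtype_ne _ t]
  simp only [lt_self_iff_false, if_false, val_blockPos]
  have h : ∀ s : Fin (i + 1), ¬ (t : ℕ) + s < t := fun s => by omega
  simp only [h, if_false, Finset.sum_const_zero]
  congr 1
  refine Finset.sum_congr rfl fun p _ => ?_
  simp only [plug_of_ne _ p.2, outerPos_lt_iff p.2, Fin.val_fin_lt]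

/-- The permutation of `0, …, N` that acts by `π` on the block at `t₀` and the positions outside it,
and by `τ` inside the block. -/
def nest (t₀ : Fin (N - i + 1)) (π : Perm (Fin (N - i + 1))) (τ : Perm (Fin (i + 1))) :
    Perm (Fin (N + 1)) :=
  (slotEquiv (π.symm t₀)).symm.trans
    ((Equiv.sumCongr τ (π.subtypeEquiv (p := fun p => p ≠ π.symm t₀) (q := fun p => p ≠ t₀) fun p => by
      rw [not_iff_not, Equiv.eq_symm_apply])).trans (slotEquiv t₀))

theorem nest_blockPos {t t₀ : Fin (N - i + 1)} {π : Perm (Fin (N - i + 1))} (h : π t = t₀)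
    (τ : Perm (Fin (i + 1))) (s : Fin (i + 1)) :
    nest t₀ π τ (blockPos t s) = blockPos t₀ (τ s) := by
  obtain rfl : π.symm t₀ = t := by simp [← h]
  rw [← slotEquiv_inl]
  simp only [nest, Equiv.trans_apply, Equiv.symm_apply_apply]
  rfl

theorem nest_outerPos {t t₀ : Fin (N - i + 1)} {π : Perm (Fin (N - i + 1))} (h : π t = t₀)
    (τ : Perm (Fin (i + 1))) {p : Fin (N - i + 1)} (hp : p ≠ t) :
    nest t₀ π τ (outerPos t p) = outerPos t₀ (π p) := by
  obtain rfl : π.symm t₀ = t := by simp [← h]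
  rw [← slotEquiv_inr _ ⟨p, hp⟩]
  simp only [nest, Equiv.trans_apply, Equiv.symm_apply_apply]
  rfl

theorem apply_ne_of_ne {n : ℕ} {t t₀ p : Fin n} {π : Perm (Fin n)} (h : π t = t₀) (hp : p ≠ t) :
    π p ≠ t₀ := fun h' => hp (π.injective (h'.trans h.symm))

theorem block_comp_nest {α : Type*} (a : Fin (N + 1) → α) {t t₀ : Fin (N - i + 1)}
    {π : Perm (Fin (N - i + 1))} (h : π t = t₀) (τ : Perm (Fin (i + 1))) :
    block (a ∘ nest t₀ π τ) i t = block a i t₀ ∘ τ := by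
  ext s
  simp [block_eq_comp, nest_blockPos h]

theorem plug_comp_nest {α : Type*} (a : Fin (N + 1) → α) {t t₀ : Fin (N - i + 1)}
    {π : Perm (Fin (N - i + 1))} (h : π t = t₀) (τ : Perm (Fin (i + 1))) (y : α) :
    plug (a ∘ nest t₀ π τ) i t y = plug a i t₀ y ∘ π := by
  ext p
  by_cases hp : p = t
  · subst hp
    rw [plug_self, Function.comp_apply, h, plug_self]
  · rw [plug_of_ne _ hp, Function.comp_apply, Function.comp_apply, nest_outerPos h _ hp,
      plug_of_ne _ (apply_ne_of_ne h hp)]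

/-- Pairs inside the block give the sign of `τ`, pairs outside it that of `π`. An outside entry
passes either all of the block or none of it, so the block acts as a single entry carrying its total
degree. -/
theorem koszulSign_nest (d : Fin (N + 1) → ℤ) (t₀ : Fin (N - i + 1)) (π : Perm (Fin (N - i + 1)))
    (τ : Perm (Fin (i + 1))) :
    koszulSign (nest t₀ π τ) d =
      koszulSign π (plug d i t₀ (∑ s, block d i t₀ s)) * koszulSign τ (block d i t₀) := by
  obtain ⟨t, ht⟩ := π.surjective t₀
  have hne : ∀ p : {p // p ≠ t}, π p.1 ≠ t₀ := fun p => apply_ne_of_ne ht p.2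
  have hsum : (∑ s, block d i t₀ s) = ∑ s, d (blockPos t₀ (τ s)) :=
    (Equiv.sum_comp τ fun s => d (blockPos t₀ s)).symm
  rw [hsum]
  unfold koszulSign
  have e1 : ∀ p : {p // p ≠ t}, nest t₀ π τ (outerPos t p.1) = outerPos t₀ (π p.1) := fun p =>
    nest_outerPos ht τ p.2
  have e2 : ∀ (s : Fin (i + 1)) (p : {p // p ≠ t}), blockPos t s < outerPos t p.1 ↔ t < p.1 :=
    fun s p => blockPos_lt_outerPos p.2 s
  have e3 : ∀ (s : Fin (i + 1)) (p : {p // p ≠ t}), outerPos t p.1 < blockPos t s ↔ p.1 < t :=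
    fun s p => outerPos_lt_blockPos p.2 s
  have e4 : ∀ p q : {p // p ≠ t}, outerPos t p.1 < outerPos t q.1 ↔ p.1 < q.1 :=
    fun p q => outerPos_lt_outerPos p.2 q.2
  simp_rw [prod_slots t, nest_blockPos ht, e1, blockPos_lt_blockPos, e2, e3, e4,
    blockPos_lt_outerPos (hne _), outerPos_lt_blockPos (hne _),
    outerPos_lt_outerPos (hne _) (hne _)]
  simp_rw [Fintype.prod_eq_mul_prod_subtype_ne _ t, ht, plug_self, plug_of_ne _ (hne _)]
  simp only [lt_self_iff_false, false_and, if_false, one_mul, Finset.prod_mul_distrib,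
    block_eq_comp, Function.comp_apply]
  rw [mul_assoc, mul_comm]
  congr 1
  congr 1
  · rw [Finset.prod_comm]
    refine Finset.prod_congr rfl fun p _ => ?_
    split_ifs
    · rw [← negOnePow_sum, Finset.sum_mul]
    · simp
  · congr 1
    refine Finset.prod_congr rfl fun p _ => ?_
    split_ifs
    · rw [← negOnePow_sum, Finset.mul_sum]
    · simp

/-- The output of a degree-one operation has the degree of the block plus one; the extra one is
traded for the sign of moving the operation from slot `t₀` to slot `t`. -/
theorem negOnePow_mul_koszulSign_nest (d : Fin (N + 1) → ℤ) {t t₀ : Fin (N - i + 1)}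
    {π : Perm (Fin (N - i + 1))} (h : π t = t₀) (τ : Perm (Fin (i + 1))) :
    Int.negOnePow (degBefore d t₀) *
        (koszulSign π (plug d i t₀ ((∑ s, block d i t₀ s) + 1)) * koszulSign τ (block d i t₀)) =
      koszulSign (nest t₀ π τ) d * Int.negOnePow (degBefore (d ∘ nest t₀ π τ) t) := by
  have h1 := negOnePow_degBefore_mul_koszulSign π (plug d i t₀ (∑ s, block d i t₀ s))
    (plug d i t₀ ((∑ s, block d i t₀ s) + 1)) t t₀ h
    (fun p hp => by rw [plug_of_ne _ hp, plug_of_ne _ hp]) (by rw [plug_self, plug_self])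
  rw [← plug_comp_nest d h τ, degBefore_plug, degBefore_plug] at h1
  rw [← mul_assoc, h1, koszulSign_nest, mul_right_comm]

end Slots

/-! ### Coset representatives increasing on the fibers of a colouring -/

section Cosets

variable {n : ℕ}

/-- `σ` is increasing on each fiber of the colouring `c` of the positions. -/
abbrev IncreasingOnFibers (c : Fin n → ℕ) (σ : Perm (Fin n)) : Prop :=
  ∀ p q : Fin n, p < q → c p = c q → σ p < σ q

/-- Sorting positions lexicographically by `(c p, ρ p)` works: `c` is already monotone, so the sort
can only permute within its fibers. -/
theorem exists_increasingOnFibers {c : Fin n → ℕ} (hc : Monotone c) (ρ : Perm (Fin n)) :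
    ∃ k : Perm (Fin n), c ∘ k = c ∧ IncreasingOnFibers c (ρ * k) := by
  set f : Fin n → ℕ ×ₗ Fin n := fun p => toLex (c p, ρ p) with hf
  have hm := Tuple.monotone_sort f
  have hck : c ∘ Tuple.sort f = c := by
    have h1 : Monotone (c ∘ Tuple.sort f) := fun p q hpq =>
      Prod.Lex.monotone_fst _ _ (hm hpq)
    exact Tuple.unique_monotone (τ := 1) h1 hc
  refine ⟨Tuple.sort f, hck, fun p q hpq hcpq => ?_⟩
  have h := hm hpq.le
  simp only [hf, Function.comp_apply, Prod.Lex.toLex_le_toLex] at h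
  rw [← Function.comp_apply (f := c), ← Function.comp_apply (f := c), hck, hcpq] at h
  refine lt_of_le_of_ne (by simpa using h) fun h' => hpq.ne ?_
  exact (ρ * Tuple.sort f).injective h'

/-- An inversion of `k` would lie inside one fiber, where `σ` and `σ * k` are both increasing, which
is impossible. Together with existence, this makes the fiberwise increasing permutations
representatives of the left cosets of the stabilizer of `c`. -/
theorem eq_one_of_increasingOnFibers {c : Fin n → ℕ} (hc : Monotone c) {σ k : Perm (Fin n)}
    (hσ : IncreasingOnFibers c σ) (hk : c ∘ k = c) (hσk : IncreasingOnFibers c (σ * k)) :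
    k = 1 := by
  have hck : ∀ p, c (k p) = c p := fun p => congrFun hk p
  have hmono : StrictMono k := by
    intro p q hpq
    by_contra hlt
    have hlt : k q < k p := lt_of_le_of_ne (not_lt.1 hlt) fun h => hpq.ne (k.injective h).symm
    have h1 := hc hpq.le
    have h2 := hc hlt.le
    rw [hck, hck] at h2
    have h3 := le_antisymm h1 h2
    exact lt_asymm (hσk p q hpq h3) (hσ _ _ hlt (by rw [hck, hck, h3]))
  have hfun : (k : Fin n → Fin n) = id :=
    (StrictMono.range_inj hmono strictMono_id).1 (by simp [k.surjective.range_eq])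
  exact Equiv.ext fun p => congrFun hfun p

/-- Every `ρ` is uniquely a product of a permutation increasing on the fibers of `c` and a
permutation `b x` whose colouring `c ∘ b x` has the prescribed parameter. -/
theorem sum_increasingOnFibers_mul {B P M : Type*} [Fintype B] [DecidableEq P] [AddCommMonoid M]
    {c : Fin n → ℕ} (hc : Monotone c) {b : B → Perm (Fin n)} (hb : Function.Injective b)
    {par : B → P} (hpar : ∀ x y, par x = par y ↔ c ∘ b x = c ∘ b y)
    (hclosed : ∀ (x : B) (k : Perm (Fin n)), c ∘ k = c → ∃ y, b y = k * b x)
    (G : Perm (Fin n) → P → M) :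
    ∑ σ with IncreasingOnFibers c σ, ∑ x, G (σ * b x) (par x) =
      ∑ ρ, ∑ a ∈ univ.image par, G ρ a := by
  rw [← Finset.sum_product', ← Finset.sum_product']
  refine Finset.sum_bij (fun z _ => (z.1 * b z.2, par z.2)) ?_ ?_ ?_ ?_
  · intro z _
    simp
  · rintro ⟨σ, x⟩ hσ ⟨σ', x'⟩ hσ' h
    simp only [Prod.mk.injEq] at h
    simp only [mem_product, mem_filter, mem_univ, true_and, and_true] at hσ hσ'
    obtain ⟨h1, h2⟩ := h
    have hk : σ' * (b x' * (b x)⁻¹) = σ := by rw [← mul_assoc, ← h1, mul_inv_cancel_right]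
    -- Equal parameters mean that `b x` and `b x'` differ by an element of the stabilizer of `c`, so
    -- uniqueness of representatives applies.
    have hone : b x' * (b x)⁻¹ = 1 := by
      refine eq_one_of_increasingOnFibers hc hσ' ?_ (by rw [hk]; exact hσ)
      funext p
      have := congrFun ((hpar _ _).1 h2) ((b x)⁻¹ p)
      simpa using this.symm
    rw [hone, mul_one] at hk
    rw [mul_inv_eq_one] at hone
    rw [hk, hb hone]
  · rintro ⟨ρ, a⟩ h
    simp only [mem_product, mem_image, mem_univ, true_and] at h
    obtain ⟨x₀, rfl⟩ := h
    -- The representative of `ρ (b x₀)⁻¹` serves as `σ`; the leftover `k⁻¹` preserves `c` and is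
    -- absorbed into `b` by `hclosed`.
    obtain ⟨k, hk, hinc⟩ := exists_increasingOnFibers hc (ρ * (b x₀)⁻¹)
    have hk' : c ∘ (k⁻¹ : Perm (Fin n)) = c := by
      funext p
      have := congrFun hk (k⁻¹ p)
      simpa using this.symm
    obtain ⟨y, hy⟩ := hclosed x₀ k⁻¹ hk'
    refine ⟨(ρ * (b x₀)⁻¹ * k, y), by simpa using hinc, ?_⟩
    simp only [Prod.mk.injEq]
    refine ⟨by rw [hy]; group, ?_⟩
    rw [hpar, hy]
    funext p
    exact congrFun hk' (b x₀ p)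
  · intro z _
    rfl

end Cosets

/-! ### Cosets of nested permutations -/

section NestedCosets

variable {N : ℕ} {i : Fin (N + 1)}

/-- The block shares no colour with its complement, so the colouring `c ∘ nest t₀ π τ` reveals where
the block lies; it then splits into a colouring inside and one outside. -/
theorem comp_nest_eq_iff {M : Type*} {t₀ : Fin (N - i + 1)} {c : Fin (N + 1) → M}
    (hc : ∀ s p, p ≠ t₀ → c (blockPos t₀ s) ≠ c (outerPos t₀ p))
    (π π' : Perm (Fin (N - i + 1))) (τ τ' : Perm (Fin (i + 1))) :
    c ∘ nest t₀ π τ = c ∘ nest t₀ π' τ' ↔ π.symm t₀ = π'.symm t₀ ∧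
      (∀ s, c (blockPos t₀ (τ s)) = c (blockPos t₀ (τ' s))) ∧
      ∀ p, π p ≠ t₀ → π' p ≠ t₀ → c (outerPos t₀ (π p)) = c (outerPos t₀ (π' p)) := by
  obtain ⟨t, ht⟩ := π.surjective t₀
  obtain ⟨t', ht'⟩ := π'.surjective t₀
  rw [← (Equiv.symm_apply_eq π).2 ht.symm, ← (Equiv.symm_apply_eq π').2 ht'.symm] at *
  constructor
  · intro h
    have htt : π.symm t₀ = π'.symm t₀ := by
      refine blockPos_inj_left fun s => ?_
      rcases slot_cases (π'.symm t₀) (blockPos (π.symm t₀) s) with h' | ⟨p, hp, h'⟩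
      · exact h'
      · have := congrFun h (blockPos (π.symm t₀) s)
        rw [Function.comp_apply, nest_blockPos ht, Function.comp_apply, h',
          nest_outerPos ht' _ hp] at this
        exact absurd this (hc _ _ (apply_ne_of_ne ht' hp))
    refine ⟨htt, fun s => ?_, fun p hp hp' => ?_⟩
    · have := congrFun h (blockPos (π.symm t₀) s)
      rw [Function.comp_apply, nest_blockPos ht, Function.comp_apply, htt,
        nest_blockPos ht'] at this
      exact this
    · have hp1 : p ≠ π.symm t₀ := fun h => hp (h ▸ ht)
      have hp2 : p ≠ π'.symm t₀ := fun h => hp' (h ▸ ht')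
      have := congrFun h (outerPos (π.symm t₀) p)
      rw [Function.comp_apply, nest_outerPos ht _ hp1, Function.comp_apply, htt,
        nest_outerPos ht' _ hp2] at this
      exact this
  · rintro ⟨htt, h1, h2⟩
    funext q
    rcases slot_cases (π.symm t₀) q with ⟨s, rfl⟩ | ⟨p, hp, rfl⟩
    · rw [Function.comp_apply, nest_blockPos ht, Function.comp_apply, htt, nest_blockPos ht', h1]
    · have hp' : p ≠ π'.symm t₀ := htt ▸ hp
      rw [Function.comp_apply, nest_outerPos ht _ hp, Function.comp_apply, htt,
        nest_outerPos ht' _ hp', h2 _ (apply_ne_of_ne ht hp) (apply_ne_of_ne ht' hp')]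

theorem nest_injective (t₀ : Fin (N - i + 1)) : Function.Injective
    fun x : Perm (Fin (N - i + 1)) × Perm (Fin (i + 1)) => nest t₀ x.1 x.2 := by
  rintro ⟨π, τ⟩ ⟨π', τ'⟩ h
  -- The identity colouring separates all positions.
  have h' := (comp_nest_eq_iff (c := id) (t₀ := t₀)
    (fun s p hp => (outerPos_ne_blockPos hp s).symm) π π' τ τ').1 (by simp only at h; rw [h])
  obtain ⟨h1, h2, h3⟩ := h'
  have hτ : τ = τ' := Equiv.ext fun s => blockPos_injective t₀ (h2 s)
  have hπ : π = π' := Equiv.ext fun p => by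
    by_cases hp : p = π.symm t₀
    · rw [hp, Equiv.apply_symm_apply, h1, Equiv.apply_symm_apply]
    · have hp1 : π p ≠ t₀ := fun h => hp ((Equiv.eq_symm_apply π).2 h)
      have hp2 : π' p ≠ t₀ := fun h => hp (h1 ▸ (Equiv.eq_symm_apply π').2 h)
      exact outerPos_inj hp1 hp2 (h3 p hp1 hp2)
  rw [hπ, hτ]

/-- A colour-preserving `k` maps the block at `t₀` to itself, hence splits into `τ₁` on the block
and `π₁` off it, which are composed with `τ` and `π`. -/
theorem exists_nest_eq_mul {M : Type*} {t₀ : Fin (N - i + 1)} {c : Fin (N + 1) → M}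
    (hc : ∀ s p, p ≠ t₀ → c (blockPos t₀ s) ≠ c (outerPos t₀ p))
    (x : Perm (Fin (N - i + 1)) × Perm (Fin (i + 1))) (k : Perm (Fin (N + 1))) (hk : c ∘ k = c) :
    ∃ y : Perm (Fin (N - i + 1)) × Perm (Fin (i + 1)),
      nest t₀ y.1 y.2 = k * nest t₀ x.1 x.2 := by
  obtain ⟨π, τ⟩ := x
  obtain ⟨⟨τ₁, π₁⟩, h₁⟩ := Equiv.Perm.mem_sumCongrHom_range_of_perm_mapsTo_inl
    (σ := ((slotEquiv t₀).trans k).trans (slotEquiv t₀).symm) (by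
      rintro _ ⟨s, rfl⟩
      rcases slot_cases t₀ (k (blockPos t₀ s)) with ⟨s', h⟩ | ⟨p, hp, h⟩
      · exact ⟨s', by simp [slotEquiv_inl, h, Equiv.eq_symm_apply]⟩
      · have := congrFun hk (blockPos t₀ s)
        rw [Function.comp_apply, h] at this
        exact absurd this.symm (hc s p hp))
  have hinl : ∀ s, k (blockPos t₀ s) = blockPos t₀ (τ₁ s) := fun s => by
    have := congrArg (slotEquiv t₀) (Equiv.congr_fun h₁ (Sum.inl s))
    simpa [slotEquiv_inl] using this.symm
  have hinr : ∀ p, k (outerPos t₀ p.1) = outerPos t₀ (π₁ p).1 := fun p => by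
    have := congrArg (slotEquiv t₀) (Equiv.congr_fun h₁ (Sum.inr p))
    simpa [slotEquiv_inr] using this.symm
  obtain ⟨t, ht⟩ := π.surjective t₀
  have hfix : Equiv.Perm.ofSubtype π₁ t₀ = t₀ := Equiv.Perm.ofSubtype_apply_of_not_mem _ (by simp)
  have ht' : (Equiv.Perm.ofSubtype π₁ * π) t = t₀ := by simp [ht, hfix]
  refine ⟨(Equiv.Perm.ofSubtype π₁ * π, τ₁ * τ), Equiv.ext fun q => ?_⟩
  rcases slot_cases t q with ⟨s, rfl⟩ | ⟨p, hp, rfl⟩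
  · simp only [Perm.mul_apply, nest_blockPos ht, nest_blockPos ht', hinl]
  · have hp' := apply_ne_of_ne ht hp
    simp only [Perm.mul_apply, nest_outerPos ht _ hp, nest_outerPos ht' _ hp]
    rw [hinr ⟨π p, hp'⟩, Equiv.Perm.ofSubtype_apply_of_mem (p := fun p => p ≠ t₀) π₁ hp']

theorem sum_increasingOnFibers_mul_nest {P M : Type*} [DecidableEq P] [AddCommMonoid M]
    {t₀ : Fin (N - i + 1)} {c : Fin (N + 1) → ℕ} (hmono : Monotone c)
    (hc : ∀ s p, p ≠ t₀ → c (blockPos t₀ s) ≠ c (outerPos t₀ p))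
    {par : Perm (Fin (N - i + 1)) → Perm (Fin (i + 1)) → P}
    (hpar : ∀ π τ π' τ', par π τ = par π' τ' ↔ π.symm t₀ = π'.symm t₀ ∧
      (∀ s, c (blockPos t₀ (τ s)) = c (blockPos t₀ (τ' s))) ∧
      ∀ p, π p ≠ t₀ → π' p ≠ t₀ → c (outerPos t₀ (π p)) = c (outerPos t₀ (π' p)))
    (G : Perm (Fin (N + 1)) → P → M) :
    ∑ σ with IncreasingOnFibers c σ, ∑ π, ∑ τ, G (σ * nest t₀ π τ) (par π τ) =
      ∑ ρ, ∑ a ∈ univ.image (Function.uncurry par), G ρ a := by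
  rw [← sum_increasingOnFibers_mul hmono (nest_injective t₀) (par := Function.uncurry par)
    (fun x y => (hpar _ _ _ _).trans (comp_nest_eq_iff hc _ _ _ _).symm)
    (fun x k hk => exists_nest_eq_mul hc x k hk) G]
  refine Finset.sum_congr rfl fun σ _ => ?_
  rw [← Finset.univ_product_univ, Finset.sum_product]
  rfl

end NestedCosets

/-! ### Homogeneous tuples -/

section Homogeneous

variable {K : Type*} [Field K] {D : ℤ → Type*} [∀ i, AddCommGroup (D i)] [∀ i, Module K (D i)]

variable (K) in
/-- The entries of `a` are homogeneous of degrees `d`. -/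
def IsHom {k : ℕ} (d : Fin k → ℤ) (a : Fin k → Tot D) : Prop :=
  ∀ p, a p ∈ LinearMap.range (DirectSum.lof K ℤ D (d p))

theorem isHom_hom {k : ℕ} (d : Fin k → ℤ) (x : ∀ p, D (d p)) : IsHom K d (hom K d x) :=
  fun p => ⟨x p, rfl⟩

theorem IsHom.exists_eq_hom {k : ℕ} {d : Fin k → ℤ} {a : Fin k → Tot D} (h : IsHom K d a) :
    ∃ x : ∀ p, D (d p), a = hom K d x := by
  choose x hx using h
  exact ⟨x, funext fun p => (hx p).symm⟩

theorem IsHom.comp {k l : ℕ} {d : Fin k → ℤ} {a : Fin k → Tot D} (h : IsHom K d a)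
    (σ : Fin l → Fin k) : IsHom K (d ∘ σ) (a ∘ σ) := fun p => h (σ p)

theorem IsHom.plug {N : ℕ} {i : Fin (N + 1)} {d : Fin (N + 1) → ℤ} {a : Fin (N + 1) → Tot D}
    (h : IsHom K d a) (t : Fin (N - i + 1)) {e : ℤ} {y : Tot D}
    (hy : y ∈ LinearMap.range (DirectSum.lof K ℤ D e)) :
    IsHom K (plug d i t e) (plug a i t y) := by
  intro p
  by_cases hp : p = t
  · subst hp
    rw [plug_self, plug_self]
    exact hy
  · rw [plug_of_ne _ hp, plug_of_ne _ hp]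
    exact h _

theorem hasDegree_iff {k : ℕ} {m : ℤ} {f : Op K D k} : HasDegree m f ↔ ∀ d a, IsHom K d a →
    f a ∈ LinearMap.range (DirectSum.lof K ℤ D ((∑ p, d p) + m)) := by
  constructor
  · intro h d a ha
    obtain ⟨x, rfl⟩ := ha.exists_eq_hom
    obtain ⟨y, hy⟩ := h d x
    exact ⟨y, hy.symm⟩
  · intro h d x
    obtain ⟨y, hy⟩ := h d _ (isHom_hom d x)
    exact ⟨y, hy.symm⟩

theorem signedSum_apply {k : ℕ} {J : Type*} [Fintype J] (s : J → (Fin (k + 1) → ℤ) → ℤˣ)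
    (σ : J → Perm (Fin (k + 1))) (f : J → Op K D k) {d : Fin (k + 1) → ℤ}
    {a : Fin (k + 1) → Tot D} (ha : IsHom K d a) :
    signedSum s σ f a = ∑ j, s j d • f j (a ∘ σ j) := by
  obtain ⟨x, rfl⟩ := ha.exists_eq_hom
  exact signedSum_hom s σ f d x

theorem HasDegree.signedSum {k : ℕ} {J : Type*} [Fintype J] (s : J → (Fin (k + 1) → ℤ) → ℤˣ)
    (σ : J → Perm (Fin (k + 1))) {f : J → Op K D k} {m : ℤ} (hf : ∀ j, HasDegree m (f j)) :
    HasDegree m (signedSum s σ f) := by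
  rw [hasDegree_iff]
  intro d a ha
  rw [signedSum_apply s σ f ha]
  refine Submodule.sum_mem _ fun j _ => ?_
  have h := hasDegree_iff.1 (hf j) _ _ (ha.comp (σ j))
  rw [show ∑ p, (d ∘ σ j) p = ∑ p, d p from Equiv.sum_comp (σ j) d] at h
  rw [Units.smul_def]
  exact zsmul_mem h _

theorem HasDegree.sum {k : ℕ} {J : Type*} [Fintype J] {f : J → Op K D k} {m : ℤ}
    (hf : ∀ j, HasDegree m (f j)) : HasDegree m (∑ j, f j) := by
  rw [hasDegree_iff]
  intro d a ha
  rw [_root_.sum_apply]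
  exact Submodule.sum_mem _ fun j _ => hasDegree_iff.1 (hf j) _ _ ha

/-- The total space is the direct sum of its components, so homogeneous tuples determine a
multilinear map. -/
theorem op_ext_hom {k : ℕ} {f g : Op K D k} (h : ∀ d a, IsHom K d a → f a = g a) : f = g := by
  refine (MultilinearMap.fromDirectSumEquiv (R := K)).symm.injective ?_
  funext d
  refine MultilinearMap.ext fun x => ?_
  rw [MultilinearMap.fromDirectSumEquiv_symm_apply, MultilinearMap.fromDirectSumEquiv_symm_apply]
  exact h d _ (isHom_hom d x)

/-- The graded symmetrization of a family of operations indexed by the permutations. -/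
abbrev koszulSum {k : ℕ} (f : Perm (Fin (k + 1)) → Op K D k) : Op K D k :=
  signedSum (fun σ d => koszulSign σ d) (fun σ => σ) f

/-- Reindexing by `ρ ↦ σ * ρ` and the cocycle identity. The condition `hf` holds for every `σ` when
`f` is constant, and for `σ` fixing the last letter when `f` depends only on `ρ⁻¹(last)`. -/
theorem koszulSum_comp {k : ℕ} {f : Perm (Fin (k + 1)) → Op K D k} {σ : Perm (Fin (k + 1))}
    (hf : ∀ ρ, f (σ * ρ) = f ρ) {d : Fin (k + 1) → ℤ} {a : Fin (k + 1) → Tot D}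
    (ha : IsHom K d a) : koszulSum f (a ∘ σ) = koszulSign σ d • koszulSum f a := by
  rw [signedSum_apply _ _ _ (ha.comp σ), signedSum_apply _ _ _ ha, Finset.smul_sum]
  refine Fintype.sum_equiv (Equiv.mulLeft σ) _ _ fun ρ => ?_
  rw [Equiv.coe_mulLeft, koszulSign_mul, smul_smul, ← mul_assoc, Int.units_mul_self, one_mul, hf]
  rfl

end Homogeneous

/-! ### Insertion of operations -/

section Insertion

variable {K : Type*} [Field K] {D : ℤ → Type*} [∀ i, AddCommGroup (D i)] [∀ i, Module K (D i)]
  {N : ℕ} {i : Fin (N + 1)}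

/-- An operation applied to `(a_0, …, y, …, a_N)`, as a linear function of the entry `y` that
replaces the block at `t`. -/
def plugLinear (f : Op K D (N - i)) (a : Fin (N + 1) → Tot D) (t : Fin (N - i + 1)) :
    Tot D →ₗ[K] Tot D :=
  f.toLinearMap (plug a i t 0) t

theorem plugLinear_apply (f : Op K D (N - i)) (a : Fin (N + 1) → Tot D) (t : Fin (N - i + 1))
    (y : Tot D) : plugLinear f a t y = f (plug a i t y) := by
  rw [plug_eq_update a t y 0]
  rfl

theorem map_units_int_smul {V W : Type*} [AddCommGroup V] [AddCommGroup W] [Module K V] [Module K W]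
    (f : V →ₗ[K] W) (u : ℤˣ) (v : V) : f (u • v) = u • f v := by
  rw [Units.smul_def, Units.smul_def, map_zsmul]

/-- The value of `f` at the permutation `ρ` of `a` with `g` inserted at `t`, with its Koszul
sign. -/
def insertTerm (d : Fin (N + 1) → ℤ) (a : Fin (N + 1) → Tot D) (ρ : Perm (Fin (N + 1)))
    (t : Fin (N - i + 1)) (f : Op K D (N - i)) (g : Op K D i) : Tot D :=
  (koszulSign ρ d * Int.negOnePow (degBefore (d ∘ ρ) t)) •
    f (plug (a ∘ ρ) i t (g (block (a ∘ ρ) i t)))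

theorem insertTerm_sum_right {J : Type*} (s : Finset J) (d : Fin (N + 1) → ℤ)
    (a : Fin (N + 1) → Tot D) (ρ : Perm (Fin (N + 1))) (t : Fin (N - i + 1)) (f : Op K D (N - i))
    (g : J → Op K D i) :
    insertTerm d a ρ t f (∑ j ∈ s, g j) = ∑ j ∈ s, insertTerm d a ρ t f (g j) := by
  simp_rw [insertTerm, ← plugLinear_apply, _root_.sum_apply, map_sum, Finset.smul_sum]

/-- Inserting one symmetrized operation into another gives a sum over nested permutations. -/
theorem koszulSum_plug_koszulSum (F : Perm (Fin (N - i + 1)) → Op K D (N - i))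
    {g : Perm (Fin (i + 1)) → Op K D i} (hg : ∀ τ, HasDegree 1 (g τ)) {d : Fin (N + 1) → ℤ}
    {a : Fin (N + 1) → Tot D} (ha : IsHom K d a) (t₀ : Fin (N - i + 1)) :
    Int.negOnePow (degBefore d t₀) • koszulSum F (plug a i t₀ (koszulSum g (block a i t₀))) =
      ∑ π, ∑ τ, insertTerm d a (nest t₀ π τ) (π.symm t₀) (F π) (g τ) := by
  have hb : IsHom K (block d i t₀) (block a i t₀) := ha.comp _
  have hy := hasDegree_iff.1 (HasDegree.signedSum (fun σ d => koszulSign σ d) (fun σ => σ) hg) _ _ hb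
  rw [signedSum_apply _ _ _ (ha.plug t₀ hy), signedSum_apply _ _ _ hb, Finset.smul_sum]
  refine Finset.sum_congr rfl fun π _ => ?_
  have hπ : π (π.symm t₀) = t₀ := Equiv.apply_symm_apply _ _
  -- The entries outside the block do not depend on `τ`, so `1` may be used; this exposes the
  -- inserted entry, in which the term is linear.
  rw [← plug_comp_nest a hπ 1, ← plugLinear_apply, map_sum, Finset.smul_sum, Finset.smul_sum]
  refine Finset.sum_congr rfl fun τ _ => ?_
  rw [map_units_int_smul, smul_smul, smul_smul, mul_assoc, negOnePow_mul_koszulSign_nest d hπ τ,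
    insertTerm, plugLinear_apply, plug_comp_nest a hπ, plug_comp_nest a hπ, block_comp_nest a hπ]

theorem smul_koszulSum_plug_koszulSum (F : Perm (Fin (N - i + 1)) → Op K D (N - i))
    {g : Perm (Fin (i + 1)) → Op K D i} (hg : ∀ τ, HasDegree 1 (g τ)) {d : Fin (N + 1) → ℤ}
    {a : Fin (N + 1) → Tot D} (ha : IsHom K d a) (t₀ : Fin (N - i + 1))
    (σ : Perm (Fin (N + 1))) :
    (Int.negOnePow (degBefore (d ∘ σ) t₀) * koszulSign σ d) •
        koszulSum F (plug (a ∘ σ) i t₀ (koszulSum g (block (a ∘ σ) i t₀))) =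
      ∑ π, ∑ τ, insertTerm d a (σ * nest t₀ π τ) (π.symm t₀) (F π) (g τ) := by
  rw [mul_comm, mul_smul, koszulSum_plug_koszulSum F hg (ha.comp σ), Finset.smul_sum]
  refine Finset.sum_congr rfl fun π _ => ?_
  rw [Finset.smul_sum]
  refine Finset.sum_congr rfl fun τ _ => ?_
  rw [insertTerm, insertTerm, smul_smul, ← mul_assoc, ← koszulSign_mul]
  rfl

theorem dendR0_blockPos (t : Fin (N - i + 1)) (s : Fin (i + 1)) :
    dendR0 i t (blockPos t s) = t := by
  rw [dendR0, dif_neg (by rw [val_blockPos]; omega), dif_pos (by rw [val_blockPos]; omega)]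

theorem dendRi_blockPos (t : Fin (N - i + 1)) (s : Fin (i + 1)) :
    dendRi i t (blockPos t s) = {s} := by
  rw [dendRi, dif_pos (by rw [val_blockPos]; omega)]
  congr 1
  simp [val_blockPos]

theorem dendR0_outerPos {t p : Fin (N - i + 1)} (hp : p ≠ t) :
    dendR0 i t (outerPos t p) = p := by
  have := Fin.val_ne_of_ne hp
  unfold dendR0
  simp only [val_outerPos]
  split_ifs <;> simp only [Fin.ext_iff] <;> omega

theorem dendRi_outerPos {t p : Fin (N - i + 1)} (hp : p ≠ t) :
    dendRi i t (outerPos t p) = Finset.univ := by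
  have := Fin.val_ne_of_ne hp
  rw [dendRi, dif_neg]
  simp only [val_outerPos]
  split_ifs <;> omega

end Insertion

/-! ### Sums over shuffles -/

section Shuffles

variable {K : Type*} [Field K] {D : ℤ → Type*} [∀ i, AddCommGroup (D i)] [∀ i, Module K (D i)]
  {N : ℕ} {i : Fin (N + 1)}

/-- The only datum of `(π, τ)` that survives is the slot `t = π⁻¹(0)` where the block lands. -/
theorem sum_shuffles {d : Fin (N + 1) → ℤ} {a : Fin (N + 1) → Tot D} (ha : IsHom K d a)
    (f : Op K D (N - i)) {g : Op K D i} (hg : HasDegree 1 g) :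
    ∑ σ ∈ shuffles (N + 1) (i + 1), koszulSign σ d •
        koszulSum (fun _ => f) (plug (a ∘ σ) i 0 (koszulSum (fun _ => g) (block (a ∘ σ) i 0))) =
      ∑ ρ, ∑ t, insertTerm d a ρ t f g := by
  -- With two colours, block and complement, increasing on fibers means being a shuffle.
  set c : Fin (N + 1) → ℕ := fun p => if (p : ℕ) < i + 1 then 0 else 1 with hc
  have hblock : ∀ s : Fin (i + 1), c (blockPos (0 : Fin (N - i + 1)) s) = 0 := fun s => by
    have h := val_blockPos (0 : Fin (N - i + 1)) s
    rw [Fin.val_zero] at h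
    exact if_pos (by omega)
  have houter : ∀ p : Fin (N - i + 1), p ≠ 0 → c (outerPos 0 p) = 1 := fun p hp => by
    have h1 : (p : ℕ) ≠ 0 := Fin.val_ne_of_ne hp
    have h2 := val_outerPos_zero p
    exact if_neg (by omega)
  have h := sum_increasingOnFibers_mul_nest (t₀ := (0 : Fin (N - i + 1))) (c := c)
    (fun p q hpq => by
      have : (p : ℕ) ≤ q := hpq
      simp only [hc]
      split_ifs <;> omega)
    (fun s p hp => by rw [hblock, houter p hp]; exact zero_ne_one)
    (par := fun π _ => π.symm 0)
    (fun π τ π' τ' => by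
      simp only [hblock, implies_true, true_and, iff_self_and]
      intro _ p hp hp'
      rw [houter _ hp, houter _ hp'])
    (fun ρ t => insertTerm d a ρ t f g)
  have himage : univ.image (Function.uncurry
      fun (π : Perm (Fin (N - i + 1))) (_ : Perm (Fin (i + 1))) => π.symm 0) = univ := by
    refine Finset.eq_univ_of_forall fun t => ?_
    rw [mem_image]
    exact ⟨(Equiv.swap 0 t, 1), mem_univ _, by simp⟩
  rw [himage] at h
  rw [← h]
  refine Finset.sum_congr ?_ fun σ _ => ?_
  · ext σ
    simp only [shuffles, mem_filter, mem_univ, true_and, IncreasingOnFibers, hc]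
    constructor
    · rintro ⟨h1, h2⟩ p q hpq hcpq
      have : (p : ℕ) < q := hpq
      by_cases hq : (q : ℕ) < i + 1
      · exact h1 p q (Nat.zero_le _) hpq hq
      · refine h2 p q ?_ hpq q.2
        split_ifs at hcpq <;> omega
    · intro h
      refine ⟨fun p q _ hpq hq => h p q hpq ?_, fun p q hp hpq hq => h p q hpq ?_⟩ <;>
      · have : (p : ℕ) < q := hpq
        split_ifs <;> omega
  · rw [← smul_koszulSum_plug_koszulSum (fun _ => f) (fun _ => hg) ha 0 σ]
    simp [degBefore]

/-- The case of the mark inside the block: the last entry belongs to the inner operation, at slot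
`s` of a block placed at `t`, so the outer mark is `t`. -/
theorem sum_shufflesFix {d : Fin (N + 1) → ℤ} {a : Fin (N + 1) → Tot D} (ha : IsHom K d a)
    (f : Fin (N - i + 1) → Op K D (N - i)) {g : Fin (i + 1) → Op K D i}
    (hg : ∀ s, HasDegree 1 (g s)) :
    ∑ σ ∈ shufflesFix N (N - i),
        (Int.negOnePow (degBefore (d ∘ σ) (N - i)) * koszulSign σ d) •
        koszulSum (fun π => f (π.symm (Fin.last _))) (plug (a ∘ σ) i (Fin.last (N - i))
          (koszulSum (fun τ => g (τ.symm (Fin.last _))) (block (a ∘ σ) i (Fin.last (N - i))))) =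
      ∑ ρ : Perm (Fin (N + 1)), ∑ t, ∑ s,
        if ρ (blockPos t s) = Fin.last N then insertTerm d a ρ t (f t) (g s) else 0 := by
  -- The last position has a colour of its own, so the parameter also records its place `τ⁻¹(last)`
  -- in the block.
  set c : Fin (N + 1) → ℕ := fun p => if (p : ℕ) < N - i then 0 else if (p : ℕ) < N then 1 else 2
    with hc
  have hblock : ∀ s : Fin (i + 1), c (blockPos (Fin.last (N - i)) s) =
      if s = Fin.last _ then 2 else 1 := fun s => by
    have h1 := val_blockPos (Fin.last (N - i)) s
    have h2 : s = Fin.last _ ↔ (s : ℕ) = i := Fin.ext_iff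
    rw [Fin.val_last] at h1
    simp only [hc, h2]
    split_ifs <;> omega
  have houter : ∀ p : Fin (N - i + 1), p ≠ Fin.last _ → c (outerPos (Fin.last _) p) = 0 :=
    fun p hp => by
      have h1 : (p : ℕ) ≠ N - i := Fin.val_ne_of_ne hp
      have h2 := val_outerPos_last hp
      exact if_pos (by omega)
  have h := sum_increasingOnFibers_mul_nest (t₀ := Fin.last (N - i)) (c := c)
    (fun p q hpq => by
      have : (p : ℕ) ≤ q := hpq
      simp only [hc]
      split_ifs <;> omega)
    (fun s p hp => by rw [hblock, houter p hp]; split_ifs <;> simp)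
    (par := fun π τ => (π.symm (Fin.last _), τ.symm (Fin.last _)))
    (fun π τ π' τ' => by
      simp only [hblock, Prod.mk.injEq]
      refine and_congr_right fun _ => ⟨fun h => ⟨fun s => ?_, fun p hp hp' => ?_⟩, fun h => ?_⟩
      · simp only [← Equiv.eq_symm_apply, h]
      · rw [houter _ hp, houter _ hp']
      · have := h.1 (τ.symm (Fin.last _))
        simp only [Equiv.apply_symm_apply, if_true] at this
        rw [Equiv.eq_symm_apply]
        by_contra h'
        rw [if_neg h'] at this
        omega)
    (fun ρ x => if ρ (blockPos x.1 x.2) = Fin.last N then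
      insertTerm d a ρ x.1 (f x.1) (g x.2) else 0)
  have himage : univ.image (Function.uncurry
      fun (π : Perm (Fin (N - i + 1))) (τ : Perm (Fin (i + 1))) =>
        (π.symm (Fin.last _), τ.symm (Fin.last _))) = univ := by
    refine Finset.eq_univ_of_forall fun x => ?_
    rw [mem_image]
    exact ⟨(Equiv.swap (Fin.last _) x.1, Equiv.swap (Fin.last _) x.2), mem_univ _, by
      simp [Function.uncurry]⟩
  rw [himage] at h
  refine Eq.trans ?_ (h.trans (Finset.sum_congr rfl fun ρ _ => Fintype.sum_prod_type _))
  rw [shufflesFix]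
  have hlast : blockPos (Fin.last (N - i)) (Fin.last i) = Fin.last N := by
    simp only [Fin.ext_iff, val_blockPos, Fin.val_last]
    omega
  -- Turns the condition that `σ` fixes the last letter into a condition on the product `ρ` alone.
  have hnest : ∀ (σ : Perm (Fin (N + 1))) (π : Perm (Fin (N - i + 1))) (τ : Perm (Fin (i + 1))),
      (σ * nest (Fin.last (N - i)) π τ)
        (blockPos (π.symm (Fin.last (N - i))) (τ.symm (Fin.last i))) = σ (Fin.last N) := by
    intro σ π τ
    rw [Perm.mul_apply, nest_blockPos (Equiv.apply_symm_apply _ _), Equiv.apply_symm_apply, hlast]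
  simp only [hnest]
  rw [Finset.sum_filter, Finset.sum_filter]
  refine Finset.sum_congr rfl fun σ _ => ?_
  by_cases hσ : σ (Fin.last N) = Fin.last N
  · simp only [hσ, true_and, if_true]
    refine if_congr ?_ ?_ rfl
    · simp only [IncreasingOnFibers, hc]
      constructor
      · rintro ⟨h1, h2⟩ p q hpq hcpq
        have : (p : ℕ) < q := hpq
        by_cases hq : (q : ℕ) < N - i
        · exact h1 p q (Nat.zero_le _) hpq hq
        · refine h2 p q ?_ hpq ?_ <;> split_ifs at hcpq <;> omega
      · intro h
        refine ⟨fun p q _ hpq hq => h p q hpq ?_, fun p q hp hpq hq => h p q hpq ?_⟩ <;>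
        · have : (p : ℕ) < q := hpq
          split_ifs <;> omega
    · exact smul_koszulSum_plug_koszulSum (fun π => f (π.symm (Fin.last _))) (fun _ => hg _) ha
        (Fin.last (N - i)) σ
  · simp [hσ]

/-- The case of the mark outside the block, at outer slot `p`. The inner mark comes from the
singled-out entry of the `(i, 1, N - i - 1)`-shuffle, which is arbitrary; so `s` is free, producing
the formal sum `[1] + ⋯ + [l]` of `R_i`. -/
theorem sum_shufflesOne (hi : (i : ℕ) < N) {d : Fin (N + 1) → ℤ} {a : Fin (N + 1) → Tot D}
    (ha : IsHom K d a) (f : Fin (N - i + 1) → Op K D (N - i)) {g : Fin (i + 1) → Op K D i}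
    (hg : ∀ s, HasDegree 1 (g s)) :
    ∑ σ ∈ shufflesOne N i, koszulSign σ d •
        koszulSum (fun π => f (π.symm (Fin.last _))) (plug (a ∘ σ) i 0
          (koszulSum (fun τ => g (τ.symm (Fin.last _))) (block (a ∘ σ) i 0))) =
      ∑ ρ : Perm (Fin (N + 1)), ∑ t, ∑ s, ∑ p, if p ≠ t ∧ ρ (outerPos t p) = Fin.last N then
        insertTerm d a ρ t (f p) (g s) else 0 := by
  -- Both the inner mark (position `i`) and the last position get a colour of their own, so three
  -- data survive: `π⁻¹(0)`, `τ⁻¹(last)` and `π⁻¹(last)`.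
  set c : Fin (N + 1) → ℕ := fun p => if (p : ℕ) < i then 0 else if (p : ℕ) = i then 1
    else if (p : ℕ) < N then 2 else 3 with hc
  have h0 : (Fin.last (N - i)) ≠ 0 := by
    simp only [ne_eq, Fin.ext_iff, Fin.val_last, Fin.val_zero]
    omega
  have hblock : ∀ s : Fin (i + 1), c (blockPos (0 : Fin (N - i + 1)) s) =
      if s = Fin.last _ then 1 else 0 := fun s => by
    have h1 := val_blockPos (0 : Fin (N - i + 1)) s
    have h2 : s = Fin.last _ ↔ (s : ℕ) = i := Fin.ext_iff
    rw [Fin.val_zero] at h1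
    simp only [hc, h2]
    split_ifs <;> omega
  have houter : ∀ p : Fin (N - i + 1), p ≠ 0 → c (outerPos 0 p) =
      if p = Fin.last _ then 3 else 2 := fun p hp => by
    have h1 : (p : ℕ) ≠ 0 := Fin.val_ne_of_ne hp
    have h2 := val_outerPos_zero p
    have h3 : p = Fin.last _ ↔ (p : ℕ) = N - i := Fin.ext_iff
    simp only [hc, h3]
    split_ifs <;> omega
  have h := sum_increasingOnFibers_mul_nest (t₀ := (0 : Fin (N - i + 1))) (c := c)
    (fun p q hpq => by
      have : (p : ℕ) ≤ q := hpq
      simp only [hc]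
      split_ifs <;> omega)
    (fun s p hp => by rw [hblock, houter p hp]; split_ifs <;> simp)
    (par := fun π τ => (π.symm 0, τ.symm (Fin.last _), π.symm (Fin.last _)))
    (fun π τ π' τ' => by
      simp only [hblock, Prod.mk.injEq]
      refine and_congr_right fun h1 => ⟨fun h => ⟨fun s => ?_, fun p hp hp' => ?_⟩,
        fun h => ⟨?_, ?_⟩⟩
      · simp only [← Equiv.eq_symm_apply, h.1]
      · rw [houter _ hp, houter _ hp']
        simp only [← Equiv.eq_symm_apply, h.2]
      · have := h.1 (τ.symm (Fin.last _))
        simp only [Equiv.apply_symm_apply, if_true] at this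
        rw [Equiv.eq_symm_apply]
        by_contra h'
        rw [if_neg h'] at this
        omega
      · have hne : π' (π.symm (Fin.last _)) ≠ 0 := by
          rw [ne_eq, ← Equiv.eq_symm_apply, ← h1]
          simpa using h0
        have := h.2 (π.symm (Fin.last _)) (by simpa using h0) hne
        rw [houter _ hne, Equiv.apply_symm_apply, houter _ h0, if_pos rfl] at this
        rw [Equiv.eq_symm_apply]
        by_contra h'
        rw [if_neg h'] at this
        omega)
    (fun ρ x => if ρ (outerPos x.1 x.2.2) = Fin.last N then
      insertTerm d a ρ x.1 (f x.2.2) (g x.2.1) else 0)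
  have himage : univ.image (Function.uncurry
      fun (π : Perm (Fin (N - i + 1))) (τ : Perm (Fin (i + 1))) =>
        (π.symm 0, τ.symm (Fin.last _), π.symm (Fin.last _))) =
      univ.filter fun x => x.2.2 ≠ x.1 := by
    ext ⟨t, s, p⟩
    simp only [mem_image, mem_univ, true_and, mem_filter, Prod.exists, Function.uncurry_apply_pair,
      Prod.mk.injEq]
    constructor
    · rintro ⟨π, τ, rfl, rfl, rfl⟩
      simpa using h0
    · intro hp
      have hne : Equiv.swap t 0 p ≠ 0 := by
        rw [ne_eq, Equiv.swap_apply_eq_iff, Equiv.swap_apply_right]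
        exact hp
      -- This permutation sends `t` to `0`, then the image of `p` to the last slot; the second swap
      -- leaves `0` alone.
      refine ⟨Equiv.swap (Equiv.swap t 0 p) (Fin.last _) * Equiv.swap t 0,
        Equiv.swap (Fin.last _) s, ?_, by simp, ?_⟩
      · rw [Equiv.symm_apply_eq, Perm.mul_apply, Equiv.swap_apply_left,
          Equiv.swap_apply_of_ne_of_ne hne.symm h0.symm]
      · rw [Equiv.symm_apply_eq, Perm.mul_apply, Equiv.swap_apply_left]
  rw [himage] at h
  refine Eq.trans ?_ (h.trans (Finset.sum_congr rfl fun ρ _ => ?_))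
  swap
  · rw [Finset.sum_filter, Fintype.sum_prod_type]
    refine Finset.sum_congr rfl fun t _ => ?_
    rw [Fintype.sum_prod_type]
    simp only [ite_and]
  rw [shufflesOne]
  have hlast : outerPos (0 : Fin (N - i + 1)) (Fin.last (N - i)) = Fin.last N := by
    rw [Fin.ext_iff, val_outerPos_zero, Fin.val_last, Fin.val_last]
    omega
  have hnest : ∀ (σ : Perm (Fin (N + 1))) (π : Perm (Fin (N - i + 1))) (τ : Perm (Fin (i + 1))),
      (σ * nest 0 π τ) (outerPos (π.symm 0) (π.symm (Fin.last (N - i)))) = σ (Fin.last N) := by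
    intro σ π τ
    rw [Perm.mul_apply, nest_outerPos (Equiv.apply_symm_apply _ _) _ (by simpa using h0),
      Equiv.apply_symm_apply, hlast]
  simp only [hnest]
  rw [Finset.sum_filter, Finset.sum_filter]
  refine Finset.sum_congr rfl fun σ _ => ?_
  by_cases hσ : σ (Fin.last N) = Fin.last N
  · simp only [hσ, true_and, if_true]
    refine if_congr ?_ ?_ rfl
    · simp only [IncreasingOnFibers, hc]
      constructor
      · rintro ⟨h1, h2⟩ p q hpq hcpq
        have : (p : ℕ) < q := hpq
        by_cases hq : (q : ℕ) < i
        · exact h1 p q (Nat.zero_le _) hpq hq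
        · refine h2 p q ?_ hpq ?_ <;> split_ifs at hcpq <;> omega
      · intro h
        refine ⟨fun p q _ hpq hq => h p q hpq ?_, fun p q hp hpq hq => h p q hpq ?_⟩ <;>
        · have : (p : ℕ) < q := hpq
          split_ifs <;> omega
    · rw [← smul_koszulSum_plug_koszulSum (fun π => f (π.symm (Fin.last _))) (fun _ => hg _) ha 0 σ]
      simp [degBefore]
  · simp [hσ]

end Shuffles

/-! ### The constructions -/

section Constructions

variable {K : Type*} [Field K] {D : ℤ → Type*} [∀ i, AddCommGroup (D i)] [∀ i, Module K (D i)]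

/-- In odd degree the two terms of the bracket add up to `2 μ ∘ μ`, and `2` is invertible. -/
theorem IsDendInfty.dendCirc_eq_zero [CharZero K] {μ : DendOps K D} (hμ : IsDendInfty μ) (N : ℕ)
    (r : Fin (N + 1)) (d : Fin (N + 1) → ℤ) (x : ∀ p, D (d p)) : dendCirc 1 μ μ N r d x = 0 := by
  have h := hμ.maurerCartan N r d x
  rw [dendBracket, one_mul, Int.negOnePow_one, Units.neg_smul, one_smul, sub_neg_eq_add,
    ← two_smul K] at h
  exact (smul_eq_zero.1 h).resolve_left two_ne_zero

/-- Composing operations marked by positions, and summing over the positions. -/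
theorem sum_dendR0_dendRi {N : ℕ} {i : Fin (N + 1)} (t : Fin (N - i + 1))
    (f : Fin (N - i + 1) → Op K D (N - i)) (a : Fin (N + 1) → Tot D) (y : Fin (i + 1) → Tot D) :
    ∑ r, f (dendR0 i t r) (plug a i t (∑ s ∈ dendRi i t r, y s)) =
      ∑ p, f p (plug a i t (∑ s, y s)) := by
  rw [sum_slots t, Fintype.sum_eq_add_sum_subtype_ne _ t]
  congr 1
  · simp only [dendR0_blockPos, dendRi_blockPos, Finset.sum_singleton, ← plugLinear_apply, map_sum]
  · refine Finset.sum_congr rfl fun p _ => ?_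
    rw [dendR0_outerPos p.2, dendRi_outerPos p.2]

theorem isAInfty_dendToA [CharZero K] {μ : DendOps K D} (hμ : IsDendInfty μ) :
    IsAInfty (dendToA μ) := by
  refine ⟨fun k => HasDegree.sum (hμ.degree k), fun N d x => ?_⟩
  have h : ∑ r, dendCirc 1 μ μ N r d x = 0 :=
    Finset.sum_eq_zero fun r _ => hμ.dendCirc_eq_zero N r d x
  unfold dendCirc at h
  rw [Finset.sum_comm] at h
  rw [← h]
  refine Finset.sum_congr rfl fun i _ => ?_
  rw [Finset.sum_comm]
  refine Finset.sum_congr rfl fun t _ => ?_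
  rw [← Finset.smul_sum, sum_dendR0_dendRi, one_mul]
  simp only [dendToA, _root_.sum_apply]

theorem isLInfty_symmetrization {μ : ∀ k, Op K D k} (hμ : IsAInfty μ) :
    IsLInfty (symmetrization μ) := by
  refine ⟨fun k => HasDegree.signedSum _ _ fun _ => hμ.degree k,
    fun k σ d x => koszulSum_comp (fun _ => rfl) (isHom_hom d x), fun N d x => ?_⟩
  have ha := isHom_hom (K := K) d x
  have h : ∀ i : Fin (N + 1), ∑ σ ∈ shuffles (N + 1) (i + 1), koszulSign σ d •
      symmetrization μ (N - i)
        (plug (hom K d x ∘ σ) i 0 (symmetrization μ i (block (hom K d x ∘ σ) i 0))) =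
      ∑ ρ, ∑ t, insertTerm d (hom K d x) ρ t (μ (N - i)) (μ i) := fun i =>
    sum_shuffles ha (μ (N - i)) (hμ.degree i)
  simp only [h]
  rw [Finset.sum_comm]
  refine Finset.sum_eq_zero fun ρ _ => ?_
  simp only [insertTerm, mul_smul, ← Finset.smul_sum]
  rw [show hom K d x ∘ ρ = hom K (d ∘ ρ) fun p => x (ρ p) from rfl, hμ.relation, smul_zero]

/-- The symmetrization with marks carries `∘` of `Dend` to the pre-Lie `∘`, the mark of the `ρ`-term
being the place where `ρ` puts the last entry. -/
theorem mnCirc_dendToPreLie {μ : DendOps K D} (hμ : ∀ k r, HasDegree 1 (μ k r)) (N : ℕ)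
    (d : Fin (N + 1) → ℤ) (x : ∀ p, D (d p)) :
    mnCirc 1 (dendToPreLie μ) (dendToPreLie μ) N d x =
      ∑ ρ : Perm (Fin (N + 1)), koszulSign ρ d •
        dendCirc 1 μ μ N (ρ.symm (Fin.last N)) (d ∘ ρ) fun p => x (ρ p) := by
  have ha := isHom_hom (K := K) d x
  have h1 : ∀ i : Fin (N + 1), (if (i : ℕ) < N then
      ∑ σ ∈ shufflesOne N i, koszulSign σ d • dendToPreLie μ (N - i)
        (plug (hom K d x ∘ σ) i 0 (dendToPreLie μ i (block (hom K d x ∘ σ) i 0))) else 0) =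
      ∑ ρ : Perm (Fin (N + 1)), ∑ t, ∑ s, ∑ p, if p ≠ t ∧ ρ (outerPos t p) = Fin.last N then
        insertTerm d (hom K d x) ρ t (μ (N - i) p) (μ i s) else 0 := by
    intro i
    split_ifs with hi
    · exact sum_shufflesOne hi ha (μ (N - i)) (hμ i)
    -- For `i = N` the outer operation is unary, so no slot lies outside the block and both sides
    -- vanish.
    · have : ∀ p t : Fin (N - i + 1), p = t := fun p t => by
        rw [Fin.ext_iff]
        omega
      refine (Finset.sum_eq_zero fun ρ _ => Finset.sum_eq_zero fun t _ =>
        Finset.sum_eq_zero fun s _ => Finset.sum_eq_zero fun p _ => if_neg ?_).symm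
      exact fun h => h.1 (this p t)
  have h2 : ∀ i : Fin (N + 1), ∑ σ ∈ shufflesFix N (N - i),
      (Int.negOnePow (1 * degBefore (d ∘ σ) (N - i)) * koszulSign σ d) •
        dendToPreLie μ (N - i) (plug (hom K d x ∘ σ) i (Fin.last (N - i))
          (dendToPreLie μ i (block (hom K d x ∘ σ) i (Fin.last (N - i))))) =
      ∑ ρ : Perm (Fin (N + 1)), ∑ t, ∑ s, if ρ (blockPos t s) = Fin.last N then
        insertTerm d (hom K d x) ρ t (μ (N - i) t) (μ i s) else 0 := by
    intro i
    simp only [one_mul]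
    exact sum_shufflesFix ha (μ (N - i)) (hμ i)
  unfold mnCirc
  simp only [h1, h2, ← Finset.sum_add_distrib]
  rw [Finset.sum_comm]
  refine Finset.sum_congr rfl fun ρ _ => ?_
  unfold dendCirc
  rw [Finset.smul_sum]
  refine Finset.sum_congr rfl fun i _ => ?_
  rw [Finset.smul_sum]
  refine Finset.sum_congr rfl fun t _ => ?_
  have hterm : ∀ r, koszulSign ρ d • Int.negOnePow (1 * degBefore (d ∘ ρ) t) •
      μ (N - i) (dendR0 i t r) (plug (hom K (d ∘ ρ) fun p => x (ρ p)) i t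
        (∑ s ∈ dendRi i t r, μ i s (block (hom K (d ∘ ρ) fun p => x (ρ p)) i t))) =
      ∑ s ∈ dendRi i t r, insertTerm d (hom K d x) ρ t (μ (N - i) (dendR0 i t r)) (μ i s) := by
    intro r
    rw [← insertTerm_sum_right, insertTerm, mul_smul, one_mul, _root_.sum_apply]
    rfl
  rw [hterm]
  simp only [← Equiv.eq_symm_apply]
  rw [Finset.sum_add_distrib]
  -- Exactly one of the two sums survives, according to whether the mark falls inside or outside the
  -- block.
  rcases slot_cases t (ρ.symm (Fin.last N)) with ⟨s, h⟩ | ⟨p, hp, h⟩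
  · have hne : ∀ p, ¬ (p ≠ t ∧ outerPos t p = blockPos t s) := fun p hp =>
      outerPos_ne_blockPos hp.1 _ hp.2
    rw [h, dendRi_blockPos, dendR0_blockPos, Finset.sum_singleton]
    simp only [hne, if_false, Finset.sum_const_zero, zero_add, (blockPos_injective t).eq_iff,
      Finset.sum_ite_eq', mem_univ, if_true]
  · have hne : ∀ s, blockPos t s ≠ outerPos t p := fun s => (outerPos_ne_blockPos hp s).symm
    have heq : ∀ q, (q ≠ t ∧ outerPos t q = outerPos t p) ↔ q = p := fun q =>
      ⟨fun hq => outerPos_inj hq.1 hp hq.2, fun hq => by rw [hq]; exact ⟨hp, rfl⟩⟩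
    rw [h, dendRi_outerPos hp, dendR0_outerPos hp]
    simp only [hne, heq, if_false, Finset.sum_const_zero, add_zero, Finset.sum_ite_eq', mem_univ,
      if_true]

theorem isPreLieInfty_dendToPreLie [CharZero K] {μ : DendOps K D} (hμ : IsDendInfty μ) :
    IsPreLieInfty (dendToPreLie μ) := by
  refine ⟨fun k => HasDegree.signedSum _ _ fun _ => hμ.degree k _, fun k σ hσ d x => ?_,
    fun N d x => ?_⟩
  · refine koszulSum_comp (fun ρ => ?_) (isHom_hom d x)
    congr 1
    rw [Equiv.symm_apply_eq, Perm.mul_apply, Equiv.apply_symm_apply, hσ]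
  · have h : mnCirc 1 (dendToPreLie μ) (dendToPreLie μ) N d x = 0 := by
      rw [mnCirc_dendToPreLie hμ.degree]
      exact Finset.sum_eq_zero fun ρ _ => by rw [hμ.dendCirc_eq_zero, smul_zero]
    rw [mnBracket, h, smul_zero, sub_zero]

/-- The inversions are exactly the pairs formed by the entry `i` and an entry after it. -/
theorem koszulSign_moveToEnd {k : ℕ} (i : Fin (k + 1)) (d : Fin (k + 1) → ℤ) :
    koszulSign (moveToEnd i) d = Int.negOnePow (d i * degAfter d i) := by
  rw [degAfter, Finset.mul_sum, negOnePow_sum, Fin.prod_univ_succAbove _ i]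
  unfold koszulSign
  rw [Fin.prod_univ_castSucc]
  simp only [Fin.prod_univ_castSucc, moveToEnd_last, moveToEnd_castSucc, Fin.castSucc_lt_castSucc_iff,
    (Fin.strictMono_succAbove i).lt_iff_lt, Fin.castSucc_lt_last, true_and, lt_self_iff_false,
    false_and, if_false, mul_one, mul_zero, Int.negOnePow_zero, one_mul]
  have h1 : ∀ p q : Fin k, ¬ (p < q ∧ q < p) := fun p q h => lt_asymm h.1 h.2
  have h2 : ∀ p : Fin k, ¬ (Fin.last k < p.castSucc) := fun p => (Fin.castSucc_lt_last p).not_gt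
  simp only [h1, h2, false_and, if_false, Finset.prod_const_one, one_mul, mul_one]
  refine Finset.prod_congr rfl fun p _ => ?_
  split_ifs <;> simp [mul_comm]

theorem symmetrization_dendToA_eq (μ : DendOps K D) :
    symmetrization (dendToA μ) = subadjacent (dendToPreLie μ) := by
  funext k
  refine op_ext_hom fun d a ha => ?_
  have h1 : symmetrization (dendToA μ) k a =
      ∑ σ : Perm (Fin (k + 1)), koszulSign σ d • ∑ i, μ k (σ.symm i) (a ∘ σ) := by
    rw [symmetrization, signedSum_apply _ _ _ ha]
    refine Finset.sum_congr rfl fun σ _ => ?_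
    -- The sum over marks is reindexed by the entry `i` standing at the mark.
    rw [dendToA, _root_.sum_apply, Equiv.sum_comp σ.symm fun r => μ k r (a ∘ σ)]
  rw [h1, subadjacent, signedSum_apply _ _ _ ha]
  simp only [Finset.smul_sum]
  rw [Finset.sum_comm]
  refine Finset.sum_congr rfl fun i _ => ?_
  rw [dendToPreLie, signedSum_apply _ _ _ (ha.comp _), Finset.smul_sum]
  refine (Fintype.sum_equiv (Equiv.mulLeft (moveToEnd i)) _ _ fun σ => ?_).symm
  rw [Equiv.coe_mulLeft, koszulSign_mul, koszulSign_moveToEnd, smul_smul]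
  have h : (moveToEnd i * σ).symm i = σ.symm (Fin.last k) := by
    rw [Equiv.symm_apply_eq, Perm.mul_apply, Equiv.apply_symm_apply, moveToEnd_last]
  rw [h]
  rfl

end Constructions

end HomotopyDend

end

open HomotopyDend in
theorem mainTheorem11 {K : Type*} [Field K] [CharZero K]
    {D : ℤ → Type*} [∀ i, AddCommGroup (D i)] [∀ i, Module K (D i)]
    (μ : DendOps K D) (hμ : IsDendInfty μ) :
    IsAInfty (dendToA μ) ∧
    IsLInfty (symmetrization (dendToA μ)) ∧
    IsPreLieInfty (dendToPreLie μ) ∧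
    IsLInfty (subadjacent (dendToPreLie μ)) ∧
    symmetrization (dendToA μ) = subadjacent (dendToPreLie μ) := by
  have hA := isAInfty_dendToA hμ
  have hL := isLInfty_symmetrization hA
  have h := symmetrization_dendToA_eq μ
  -- The subadjacent structure is `L_∞` by transport along (c), without using the pre-Lie relation.
  exact ⟨hA, hL, isPreLieInfty_dendToPreLie hμ, h ▸ hL, h⟩
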